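/- Let $p$ be an odd prime and let $A$ be a commutative (associative, non-unital) nilpotent $\mathbb F_p$-algebra of dimension $n$ with $A^3=0$ and $\dim_{\mathbb F_p}(A^2)=1$. Suppose that $A$ has a basis $z_1,\dots,z_n$ with $z_iz_j=\Phi_{ij}z_n$ for all $i,j$, where $\Phi=\mathrm{diag}(D_s,0)$ and $D_s=\mathrm{diag}(1,\dots,1,s)$ is a $k\times k$ matrix over $\mathbb F_p$, $k\le n-1$. A regular subgroup $T$ of the affine group $\mathrm{Aff}_n(\mathbb F_p)$ is *associated to $A$* if there is an algebra structure $\cdot$ on the vector space $\mathbb F_p^n$, isomorphic to $A$, such that $T=\{\tau(x):x\in\mathbb F_p^n\}$, where $\tau(x)(y)=x+y+x\cdot y$. Let $\mathrm{GO}_{2m+1}$ denote the orthogonal (isometry) group over $\mathbb F_p$ of $x_1^2+\dots+x_{2m+1}^2$; let $\mathrm{GO}^+_{2m}$ denote the orthogonal group of a sum of $m$ hyperbolic planes, and, for $m\ge1$, $\mathrm{GO}^-_{2m}$ that of a sum of $m-1$ hyperbolic planes and an anisotropic plane. For even $k$, let $\mathrm O(D_s)=\{U\in \mathrm{GL}_{k}(\mathbb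 F_p): U^TD_sU=D_s\}$. Then the number of regular subgroups of $\mathrm{Aff}_n(\mathbb F_p)$ associated to $A$ is as follows. 1. If $k=2m+1$ and $s=1$: $$\frac{|\mathrm{GL}_n(\mathbb F_p)|}{\frac{p-1}2\cdot|\mathrm{GO}_{2m+1}|\cdot|\mathrm{GL}_{n-1-k}(\mathbb F_p)|\cdot p^{k(n-1-k)+(n-1)}}.$$ 2. If $k=2m$ and $s=1$: $$\frac{|\mathrm{GL}_n(\mathbb F_p)|}{(p-1)\cdot|\mathrm O(D_1)|\cdot|\mathrm{GL}_{n-1-k}(\mathbb F_p)|\cdot p^{k(n-1-k)+(n-1)}},$$ where $|\mathrm O(D_1)|$ may be replaced by $|\mathrm{GO}^+_{2m}|$ if $m$ is even or $p\equiv1\pmod 4$, and by $|\mathrm{GO}^-_{2m}|$ if $m$ is odd and $p\equiv3\pmod 4$. 3. If $k=2m$ and $s$ is a non-square in $\mathbb F_p$: $$\frac{|\mathrm{GL}_n(\mathbb F_p)|}{(p-1)\cdot|\mathrm O(D_s)|\cdot|\mathrm{GL}_{n-1-k}(\mathbb F_p)|\cdot p^{k(n-1-k)+(n-1)}},$$ where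 $|\mathrm O(D_s)|$ may be replaced by $|\mathrm{GO}^-_{2m}|$ if $m$ is even or $p\equiv1\pmod 4$, and by $|\mathrm{GO}^+_{2m}|$ if $m$ is odd and $p\equiv3\pmod 4$. Moreover, let $L/K$ be any Galois extension of fields with Galois group identified with $G=(\mathbb F_p^n,+)$. A Hopf Galois structure on $L/K$ is a finite cocommutative $K$-Hopf algebra $H$ for which $L$ is an $H$-module algebra and the map $L\otimes_KH\to\mathrm{End}_K(L)$, $b\otimes h\mapsto(a\mapsto b\,h(a))$, is bijective. Two such structures are identified if they are related by an isomorphism of Hopf algebras compatible with the actions. Such a structure is associated to $A$ if it arises by Galois descent from a regular subgroup $T$ associated to $A$, that is, if $H\cong(L[T])^G$, where $G$ acts on $L$ as the Galois group and on $T$ by conjugation with translations, and $H$ acts on $L$ by $\left(\sum_t c_t t\right)(a)=\sum_t c_t\,\bigl(t^{-1}(0)\bigr)(a)$. Then the number of Hopf Galois structures on $L/K$ associated to $A$ equals the number of regular subgroups of $\mathrm{Aff}_n(\mathbb F_p)$ associated to $A$. -/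

import Mathlib

open scoped TensorProduct

universe u v

noncomputable section

/-! ### Commutative nilpotent algebras and regular subgroups of the affine group -/

/-- The vector space `𝔽_p ^ n`. -/
abbrev FpVec (p n : ℕ) : Type := Fin n → ZMod p

/-- The affine group of `𝔽_p ^ n` (the matrices with block rows `(B, v)`, `(0, 1)`, that is,
the maps `y ↦ B y + v` with `B` invertible); it is the holomorph of `(𝔽_p ^ n, +)`. -/
abbrev AffGroup (p n : ℕ) : Type := FpVec p n ≃ᵃ[ZMod p] FpVec p n

/-- The translation `z ↦ g + z`. -/
def translation (p n : ℕ) (g : FpVec p n) : AffGroup p n :=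
  AffineEquiv.constVAdd (ZMod p) (FpVec p n) g

/-- A group of affine maps is regular if it acts simply transitively on `𝔽_p ^ n`. -/
def IsRegularSubgroup {p n : ℕ} (T : Subgroup (AffGroup p n)) : Prop :=
  ∀ x y : FpVec p n, ∃! t : AffGroup p n, t ∈ T ∧ t x = y

/-- The map `τ(x) : y ↦ x ∘ y = x + y + x * y`, where `x * y = μ x y`. -/
def circleProductMap {p n : ℕ} (μ : FpVec p n →ₗ[ZMod p] FpVec p n →ₗ[ZMod p] FpVec p n)
    (x : FpVec p n) : FpVec p n → FpVec p n :=
  fun y => x + y + μ x y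

/-- `T` is associated to (the isomorphism type of) the algebra `A`: there is an algebra structure
on the vector space `𝔽_p ^ n`, isomorphic to `A`, such that `T = {τ(x) : x ∈ 𝔽_p ^ n}`. -/
def IsAssociated {p n : ℕ} (A : Type*) [NonUnitalCommRing A] [Module (ZMod p) A]
    (T : Subgroup (AffGroup p n)) : Prop :=
  ∃ μ : FpVec p n →ₗ[ZMod p] FpVec p n →ₗ[ZMod p] FpVec p n,
    (∃ e : A ≃ₗ[ZMod p] FpVec p n, ∀ x y : A, e (x * y) = μ (e x) (e y)) ∧
    (fun t : AffGroup p n => (t : FpVec p n → FpVec p n)) '' (T : Set (AffGroup p n)) =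
      Set.range (circleProductMap μ)

/-- The regular subgroups of the affine group that are associated to `A`. -/
def associatedRegularSubgroups (p n : ℕ) (A : Type*) [NonUnitalCommRing A] [Module (ZMod p) A] :
    Set (Subgroup (AffGroup p n)) :=
  {T | IsRegularSubgroup T ∧ IsAssociated A T}

/-- `A²`, the span of all products of two elements. -/
def squareSpan (p : ℕ) (A : Type*) [NonUnitalCommRing A] [Module (ZMod p) A] :
    Submodule (ZMod p) A :=
  Submodule.span (ZMod p) {z | ∃ x y : A, z = x * y}

/-- `Φ` is a structure matrix of `A`: there is a basis `z_1, …, z_n` of `A` such that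
`z_i * z_j = Φ i j • z_n` for all `i`, `j`. -/
def IsStructureMatrix {p n : ℕ} (A : Type*) [NonUnitalCommRing A] [Module (ZMod p) A]
    (Φ : Matrix (Fin n) (Fin n) (ZMod p)) : Prop :=
  ∃ (b : Module.Basis (Fin n) (ZMod p) A) (l : Fin n), (l : ℕ) + 1 = n ∧
    ∀ i j : Fin n, b i * b j = Φ i j • b l

/-- The `k × k` matrix `D_s = diag(1, …, 1, s)`. -/
def diagOnes (p k : ℕ) (s : ZMod p) : Matrix (Fin k) (Fin k) (ZMod p) :=
  Matrix.diagonal fun i => if (i : ℕ) + 1 = k then s else 1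

/-- The `n × n` block matrix `diag(D, 0)`, for a `k × k` matrix `D` and `k ≤ n`. -/
def extendByZero {p k : ℕ} (n : ℕ) (D : Matrix (Fin k) (Fin k) (ZMod p)) :
    Matrix (Fin n) (Fin n) (ZMod p) :=
  Matrix.of fun i j =>
    if h : (i : ℕ) < k ∧ (j : ℕ) < k then D ⟨i, h.1⟩ ⟨j, h.2⟩ else 0

/-! ### Orthogonal groups -/

/-- The general orthogonal group of the bilinear form with Gram matrix `S`. -/
def isometryGroup {p : ℕ} {ι : Type} [Fintype ι] [DecidableEq ι] (S : Matrix ι ι (ZMod p)) :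
    Subgroup (GL ι (ZMod p)) where
  carrier := {U | (U : Matrix ι ι (ZMod p)).transpose * S * (U : Matrix ι ι (ZMod p)) = S}
  one_mem' := by simp
  mul_mem' := by
    intro U W hU hW
    simp only [Set.mem_ofPred_eq] at hU hW ⊢
    calc (((U * W : GL ι (ZMod p)) : Matrix ι ι (ZMod p))).transpose * S *
            ((U * W : GL ι (ZMod p)) : Matrix ι ι (ZMod p))
        = (W : Matrix ι ι (ZMod p)).transpose *
            ((U : Matrix ι ι (ZMod p)).transpose * S * (U : Matrix ι ι (ZMod p))) *
            (W : Matrix ι ι (ZMod p)) := by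
          simp [Matrix.transpose_mul, Matrix.mul_assoc]
      _ = S := by rw [hU, hW]
  inv_mem' := by
    intro U hU
    simp only [Set.mem_ofPred_eq] at hU ⊢
    have h1 : (U : Matrix ι ι (ZMod p)) * ((U⁻¹ : GL ι (ZMod p)) : Matrix ι ι (ZMod p)) = 1 :=
      Units.mul_inv U
    have h2 : (((U⁻¹ : GL ι (ZMod p)) : Matrix ι ι (ZMod p))).transpose *
        (U : Matrix ι ι (ZMod p)).transpose = 1 := by
      rw [← Matrix.transpose_mul, h1, Matrix.transpose_one]
    calc (((U⁻¹ : GL ι (ZMod p)) : Matrix ι ι (ZMod p))).transpose * S *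
            ((U⁻¹ : GL ι (ZMod p)) : Matrix ι ι (ZMod p))
        = (((U⁻¹ : GL ι (ZMod p)) : Matrix ι ι (ZMod p))).transpose *
            ((U : Matrix ι ι (ZMod p)).transpose * S * (U : Matrix ι ι (ZMod p))) *
            ((U⁻¹ : GL ι (ZMod p)) : Matrix ι ι (ZMod p)) := by rw [hU]
      _ = ((((U⁻¹ : GL ι (ZMod p)) : Matrix ι ι (ZMod p))).transpose *
            (U : Matrix ι ι (ZMod p)).transpose) * S *
            ((U : Matrix ι ι (ZMod p)) * ((U⁻¹ : GL ι (ZMod p)) : Matrix ι ι (ZMod p))) := by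
          simp only [Matrix.mul_assoc]
      _ = S := by rw [h1, h2, Matrix.one_mul, Matrix.mul_one]

/-- Gram matrix of an orthogonal sum of `m` hyperbolic planes. -/
def hyperbolicForm (p m : ℕ) : Matrix (Fin m ⊕ Fin m) (Fin m ⊕ Fin m) (ZMod p) :=
  Matrix.fromBlocks 0 1 1 0

/-- Gram matrix of the orthogonal sum of `m - 1` hyperbolic planes and the plane `x² - δ y²`,
which is anisotropic when `δ` is not a square. It has size `2 m` when `1 ≤ m`. -/
def ellipticForm (p m : ℕ) (δ : ZMod p) :
    Matrix ((Fin (m - 1) ⊕ Fin (m - 1)) ⊕ Fin 2) ((Fin (m - 1) ⊕ Fin (m - 1)) ⊕ Fin 2) (ZMod p) :=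
  Matrix.fromBlocks (hyperbolicForm p (m - 1)) 0 0 (Matrix.diagonal ![1, -δ])

/-- `|GO_k(𝔽_p)|`, used for odd `k`: the order of the orthogonal group of the form
`x_1² + … + x_k²`. -/
def cardGO (p k : ℕ) : ℕ :=
  Nat.card (isometryGroup (1 : Matrix (Fin k) (Fin k) (ZMod p)))

/-- `|GO⁺_{2m}(𝔽_p)|`: the order of the orthogonal group of the form of plus type. -/
def cardGOPlus (p m : ℕ) : ℕ :=
  Nat.card (isometryGroup (hyperbolicForm p m))

/-- `|GO⁻_{2m}(𝔽_p)|` for `1 ≤ m`: the order of the orthogonal group of the form of minus type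
(the non-square `δ` only serves to write down the form). -/
def cardGOMinus (p m : ℕ) (δ : ZMod p) : ℕ :=
  Nat.card (isometryGroup (ellipticForm p m δ))

/-- `|GL_n| / (c · o · |GL_{n-1-k}| · p ^ (k (n-1-k) + (n-1)))`. -/
def countFormula (p n k : ℕ) (c : ℚ) (o : ℕ) : ℚ :=
  (Nat.card (GL (Fin n) (ZMod p)) : ℚ) /
    (c * (o : ℚ) * (Nat.card (GL (Fin (n - 1 - k)) (ZMod p)) : ℚ) *
      (p : ℚ) ^ (k * (n - 1 - k) + (n - 1)))

/-! ### Hopf Galois structures -/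

/-- A Hopf Galois structure on a field extension `L/K`: a finite cocommutative `K`-Hopf algebra
`H` acting on `L` so that `L` is an `H`-module algebra and the map
`L ⊗ H → End_K(L)`, `b ⊗ h ↦ (a ↦ b * (h a))`, is bijective. -/
structure HopfGaloisStructure (K : Type u) (L : Type v) [Field K] [Field L] [Algebra K L] where
  /-- the Hopf algebra -/
  H : Type v
  [ring : Ring H]
  [hopf : HopfAlgebra K H]
  finite : Module.Finite K H
  cocomm : Coalgebra.IsCocomm K H
  /-- the action of `H` on `L` -/
  act : H →ₐ[K] Module.End K L
  act_one : ∀ h : H, act h 1 = algebraMap K L (Coalgebra.counit (R := K) h)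
  /-- `h (a b) = ∑ h₁(a) h₂(b)`, where the comultiplication of `h` is `∑ h₁ ⊗ h₂` -/
  act_mul : ∀ (h : H) (a b : L), act h (a * b) =
    TensorProduct.lift ((LinearMap.mul K L).compl₁₂
      (LinearMap.applyₗ a ∘ₗ act.toLinearMap) (LinearMap.applyₗ b ∘ₗ act.toLinearMap))
      (Coalgebra.comul (R := K) h)
  galois : Function.Bijective
    (TensorProduct.lift ((LinearMap.mul K (Module.End K L)).compl₁₂
      (LinearMap.mul K L) act.toLinearMap) : L ⊗[K] H →ₗ[K] Module.End K L)

attribute [instance] HopfGaloisStructure.ring HopfGaloisStructure.hopf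

namespace HopfGaloisStructure

variable {K : Type u} {L : Type v} [Field K] [Field L] [Algebra K L]

/-- Two Hopf Galois structures are the same if there is an isomorphism of Hopf algebras
compatible with the actions on `L`. -/
def Iso (S S' : HopfGaloisStructure K L) : Prop :=
  ∃ f : S.H ≃ₐc[K] S'.H, ∀ h : S.H, S'.act (f h) = S.act h

theorem Iso.refl (S : HopfGaloisStructure K L) : S.Iso S :=
  ⟨BialgEquiv.refl K S.H, fun _ => rfl⟩

theorem Iso.symm {S S' : HopfGaloisStructure K L} (h : S.Iso S') : S'.Iso S := by
  obtain ⟨f, hf⟩ := h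
  refine ⟨f.symm, fun x => ?_⟩
  rw [← hf (f.symm x), BialgEquiv.apply_symm_apply]

theorem Iso.trans {S S' S'' : HopfGaloisStructure K L} (h : S.Iso S') (h' : S'.Iso S'') :
    S.Iso S'' := by
  obtain ⟨f, hf⟩ := h
  obtain ⟨g, hg⟩ := h'
  exact ⟨f.trans g, fun x => (hg (f x)).trans (hf x)⟩

instance isoSetoid (K : Type u) (L : Type v) [Field K] [Field L] [Algebra K L] :
    Setoid (HopfGaloisStructure K L) where
  r := Iso
  iseqv := ⟨Iso.refl, Iso.symm, Iso.trans⟩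

/-- `S` is the Hopf Galois structure that arises by Galois descent from a regular subgroup `T` of
the affine group of `G = 𝔽_p ^ n` normalized by the translations `λ(G)`, where `G` is identified
with the Galois group of `L/K` by `σ`. Namely, `H` is identified by `φ` with the fixed ring
`(L[T])^G`, where `g ∈ G` acts on `L` by `σ g` and on `T` by conjugation by `λ(g)`; the
comultiplication and counit of `H` are those induced from the group ring `L[T]`; and the action on
`L` is `(∑ c_t t)(a) = ∑ c_t · σ(t⁻¹(0))(a)`. -/
def ArisesFrom {p n : ℕ} (S : HopfGaloisStructure K L)
    (σ : Multiplicative (FpVec p n) ≃* (L ≃ₐ[K] L)) (T : Subgroup (AffGroup p n)) : Prop :=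
  (∀ g : FpVec p n, ∀ t ∈ T, translation p n g * t * (translation p n g)⁻¹ ∈ T) ∧
  ∃ φ : S.H →ₐ[K] MonoidAlgebra L T,
    Function.Injective φ ∧
    (∀ b : MonoidAlgebra L T, (∃ h : S.H, φ h = b) ↔
      ∀ (g : FpVec p n) (t t' : T),
        (t' : AffGroup p n) = translation p n g * (t : AffGroup p n) * (translation p n g)⁻¹ →
          b.coeff t' = σ (Multiplicative.ofAdd g) (b.coeff t)) ∧
    (∀ h : S.H, Coalgebra.counit (R := L) (φ h) =
      algebraMap K L (Coalgebra.counit (R := K) h)) ∧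
    (∀ h : S.H, Coalgebra.comul (R := L) (φ h) =
      TensorProduct.mapOfCompatibleSMul L K K (MonoidAlgebra L T) (MonoidAlgebra L T)
        (TensorProduct.map φ.toLinearMap φ.toLinearMap (Coalgebra.comul (R := K) h))) ∧
    (∀ (h : S.H) (a : L), S.act h a =
      (φ h).coeff.sum fun t c =>
        c * σ (Multiplicative.ofAdd ((t⁻¹ : AffGroup p n) 0)) a)

end HopfGaloisStructure

/-- The Hopf Galois structures on `L/K` (up to isomorphism) that arise from the regular subgroups
associated to the isomorphism type of `A`. -/
def associatedHopfGaloisStructures (K : Type u) (L : Type v) [Field K] [Field L] [Algebra K L]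
    {p n : ℕ} (σ : Multiplicative (FpVec p n) ≃* (L ≃ₐ[K] L))
    (A : Type*) [NonUnitalCommRing A] [Module (ZMod p) A] :
    Set (Quotient (HopfGaloisStructure.isoSetoid K L)) :=
  {q | ∃ S : HopfGaloisStructure K L, Quotient.mk _ S = q ∧
    ∃ T ∈ associatedRegularSubgroups p n A, S.ArisesFrom σ T}

end

/-! Counting the subgroups. A subgroup associated to `A` consists of the maps τ(x) : y ↦ x + y +
x·y. Since τ(x)(0) = x, it determines the product, so associated subgroups correspond to algebra
structures on 𝔽_p^n isomorphic to `A` (`ncard_associatedRegularSubgroups`). Every such structure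
gives a regular group because the product is commutative with A³ = 0. The structures form one orbit
of GL_n with stabilizer Aut(A), so their number is |GL_n| / |Aut(A)|
(`ncard_transportedStructures_mul_card`).

In the given basis an automorphism is an invertible matrix M whose last column is c·e_n and which
satisfies MᵀΦM = cΦ. In blocks of sizes k, n-1-k, 1 this leaves a similitude of `D_s` with
multiplier c, an element of GL_{n-1-k}, and free entries (`card_block_matrices`). Similitudes with a
given multiplier c are either absent or as numerous as the isometries, and they exist iff c·D_s is
congruent to D_s. Over a finite field of odd characteristic, rank and determinant modulo squares
classify nondegenerate forms (`isCongruent_diagonal_of_isSquare`). Hence every c occurs for even k,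
and for odd k only the squares do, which gives the factors p - 1 and (p - 1)/2. The same
classification decides whether `D_s` has plus or minus type.

Hopf Galois structures. Because A³ = 0, the translations normalize T, so G acts on T. The fixed ring
L[T]^G is the space of equivariant functions T → L. Dedekind's independence of automorphisms gives
the required descent: this space has K-dimension |T|, K-independent elements stay L-independent, and
tensors over K embed into functions of several variables. The Hopf axioms then become identities
between such functions, with comultiplication supported on the diagonal. The action on L is
multiplicative because t ↦ σ(t⁻¹(0)) is a crossed bijection (`regularEquiv_mul_translationConj`).

Conversely, the structure determines T. By Dedekind the operators on L determine the coefficients;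
equivariant functions separate points, so the Galois action on T is recovered, and from it the maps
t⁻¹ themselves (`le_of_iso`). Two structures arising from the same T are isomorphic
(`iso_of_arisesFrom`). -/

noncomputable section

/-! ### Galois descent for equivariant functions. -/

section Descent

variable {K : Type*} {L : Type*} [Field K] [Field L] [Algebra K L]

/-- Dedekind's independence of field automorphisms. -/
theorem eq_zero_of_sum_mul_algEquiv_eq_zero [Fintype (L ≃ₐ[K] L)]
    (w : (L ≃ₐ[K] L) → L) (h : ∀ a : L, ∑ g, w g * g a = 0) (g : L ≃ₐ[K] L) : w g = 0 := by
  have hli : LinearIndependent L (fun g : L ≃ₐ[K] L => (g : L → L)) :=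
    (linearIndependent_monoidHom L L).comp
      (fun g : L ≃ₐ[K] L => ((g : L →ₐ[K] L) : L →* L)) fun g g' hgg => by
        ext a
        exact DFunLike.congr_fun hgg a
  exact Fintype.linearIndependent_iff.1 hli w (by ext a; simpa using h a) g

variable {X : Type*} (ρ : (L ≃ₐ[K] L) →* Equiv.Perm X)

/-- The functions `X → L` that are equivariant for an action of the automorphism group of `L/K`
on `X`, that is, the fixed points of the semilinear action of that group on `X → L`. -/
def equivariantFunctions : Submodule K (X → L) where
  carrier := {c | ∀ g x, c (ρ g x) = g (c x)}
  add_mem' := by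
    intro a b ha hb g x
    simp [ha g x, hb g x]
  zero_mem' := by
    intro g x
    simp
  smul_mem' := by
    intro r a ha g x
    simp [ha g x]

section OrbitSum

variable [Fintype (L ≃ₐ[K] L)] [DecidableEq X]

/-- The equivariant function obtained by summing the translates of the function that is `a` at `y`
and `0` elsewhere. -/
def orbitSum (a : L) (y : X) : X → L := fun x => ∑ g : L ≃ₐ[K] L, if ρ g y = x then g a else 0

theorem orbitSum_mem (a : L) (y : X) : orbitSum ρ a y ∈ equivariantFunctions ρ := by
  intro g x
  simp only [orbitSum, map_sum]
  rw [← Equiv.sum_comp (Equiv.mulLeft g)]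
  refine Finset.sum_congr rfl fun h _ => ?_
  rw [Equiv.coe_mulLeft]
  have : (ρ (g * h) y = ρ g x) ↔ (ρ h y = x) := by
    rw [map_mul, Equiv.Perm.mul_apply, (ρ g).injective.eq_iff]
  by_cases hx : ρ h y = x
  · rw [if_pos hx, if_pos (this.2 hx), AlgEquiv.mul_apply]
  · rw [if_neg hx, if_neg (mt this.1 hx), map_zero]

/-- Testing against the orbit sum of a at y turns the relation into Σ_g w(g·y) g(a) = 0 for all a;
Dedekind's theorem at g = 1 gives w(y) = 0. This says that the equivariant functions span X → L over
L. -/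
theorem eq_zero_of_sum_mul_equivariantFunctions [Fintype X] (w : X → L)
    (h : ∀ c ∈ equivariantFunctions ρ, ∑ x, w x * c x = 0) (y : X) : w y = 0 := by
  have := eq_zero_of_sum_mul_algEquiv_eq_zero (K := K) (fun g => w (ρ g y)) (fun a => ?_) 1
  · simpa using this
  · rw [← h _ (orbitSum_mem ρ a y)]
    simp only [orbitSum, Finset.mul_sum]
    rw [Finset.sum_comm]
    simp

theorem eq_of_forall_equivariantFunctions {x y : X}
    (h : ∀ c ∈ equivariantFunctions ρ, c x = c y) : x = y := by
  by_contra hxy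
  -- Equality of all orbit sums of y at x and at y is a relation between automorphisms. For x ≠ y
  -- its coefficient at g = 1 would be -1.
  have := eq_zero_of_sum_mul_algEquiv_eq_zero (K := K)
    (fun g : L ≃ₐ[K] L => (if ρ g y = x then 1 else 0) - (if ρ g y = y then 1 else 0))
    (fun a => ?_) 1
  · simp [Ne.symm hxy] at this
  · have := h _ (orbitSum_mem ρ a y)
    simp only [orbitSum] at this
    simp [sub_mul, this]

end OrbitSum

/-! ### Tensor products of spaces of functions -/

/-- The function of two variables attached to a tensor, for `K`-linear maps to spaces of
`L`-valued functions. -/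
def tensorToFun {Y A B : Type*} [AddCommMonoid A] [Module K A] [AddCommMonoid B] [Module K B]
    (α : A →ₗ[K] X → L) (β : B →ₗ[K] Y → L) : A ⊗[K] B →ₗ[K] X × Y → L :=
  TensorProduct.lift (LinearMap.mk₂ K (fun a b (z : X × Y) => α a z.1 * β b z.2)
    (fun a a' b => by ext; simp [add_mul]) (fun r a b => by ext; simp)
    (fun a b b' => by ext; simp [mul_add]) (fun r a b => by ext; simp))

@[simp]
theorem tensorToFun_tmul {Y A B : Type*} [AddCommMonoid A] [Module K A] [AddCommMonoid B]
    [Module K B] (α : A →ₗ[K] X → L) (β : B →ₗ[K] Y → L) (a : A) (b : B) (x : X) (y : Y) :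
    tensorToFun α β (a ⊗ₜ b) (x, y) = α a x * β b y := by
  simp [tensorToFun]

variable [FiniteDimensional K L] [IsGalois K L]

/-- Multiplying an L-relation by a and averaging over the Galois group replaces each coefficient w
by Tr(a·w), which lies in K. So all these traces vanish, and nondegeneracy of the trace, in the form
of Dedekind's theorem, gives w = 0. -/
theorem linearIndependent_of_mem_equivariantFunctions {ι : Type*} {b : ι → X → L}
    (hb : ∀ i, b i ∈ equivariantFunctions ρ) (hli : LinearIndependent K b) :
    LinearIndependent L b := by
  rw [linearIndependent_iff'] at hli ⊢
  intro s w hw i hi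
  have htr : ∀ a : L, ∑ g : L ≃ₐ[K] L, g (a * w i) = 0 := by
    intro a
    rw [← trace_eq_sum_automorphisms]
    rw [hli s (fun i => Algebra.trace K L (a * w i)) ?_ i hi, map_zero]
    ext x
    rw [Finset.sum_apply]
    simp only [Pi.smul_apply, Algebra.smul_def, trace_eq_sum_automorphisms, Finset.sum_mul,
      Pi.zero_apply]
    rw [Finset.sum_comm]
    refine Finset.sum_eq_zero fun g _ => ?_
    -- Evaluating at g⁻¹x before applying g makes equivariance restore `b j x`, so that only the
    -- coefficient is moved by g.
    have h0 := congrArg g (congrArg (a * ·) (congrFun hw (ρ g⁻¹ x)))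
    rw [Finset.sum_apply] at h0
    simp only [Pi.smul_apply, smul_eq_mul, Finset.mul_sum, map_sum, Pi.zero_apply, mul_zero,
      map_zero] at h0
    rw [← h0]
    refine Finset.sum_congr rfl fun j _ => ?_
    have : b j x = g (b j (ρ g⁻¹ x)) := by
      rw [← hb j g, ← Equiv.Perm.mul_apply, ← map_mul, mul_inv_cancel, map_one,
        Equiv.Perm.one_apply]
    rw [← mul_assoc, map_mul _ _ (b j _), this]
  have := eq_zero_of_sum_mul_algEquiv_eq_zero (K := K) (fun g => g (w i))
    (fun a => by simpa [mul_comm] using htr a) 1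
  simpa using this

/-- A K-basis of the equivariant functions is also an L-basis of X → L: independence is descent, and
spanning holds because no nonzero L-linear functional kills all equivariant functions. -/
theorem finrank_equivariantFunctions [Fintype X] :
    Module.finrank K (equivariantFunctions ρ) = Fintype.card X := by
  classical
  let b := Module.Basis.ofVectorSpace K (equivariantFunctions ρ)
  have hli : LinearIndependent L (fun i => (b i : X → L)) :=
    linearIndependent_of_mem_equivariantFunctions ρ (fun i => (b i).2)
      (b.linearIndependent.map' (equivariantFunctions ρ).subtype (Submodule.ker_subtype _))
  have hspan : ⊤ ≤ Submodule.span L (Set.range fun i => (b i : X → L)) := by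
    by_contra hlt
    obtain ⟨f, hf, hle⟩ := Submodule.exists_le_ker_of_lt_top _ (lt_of_le_not_ge le_top hlt)
    have hsum : ∀ c : X → L, f c = ∑ x, f (Pi.single x 1) * c x := by
      intro c
      conv_lhs => rw [pi_eq_sum_univ' c, map_sum]
      refine Finset.sum_congr rfl fun x _ => ?_
      rw [map_smul, smul_eq_mul, mul_comm]
    have hzero : ∀ c ∈ equivariantFunctions ρ, f c = 0 := by
      intro c hc
      have : (⟨c, hc⟩ : equivariantFunctions ρ) ∈ Submodule.span K (Set.range b) := by
        rw [b.span_eq]; trivial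
      refine Submodule.span_induction
        (p := fun (c : equivariantFunctions ρ) _ => f (c : X → L) = 0) ?_ ?_ ?_ ?_ this
      · rintro _ ⟨i, rfl⟩
        exact hle (Submodule.subset_span ⟨i, rfl⟩)
      · simp
      · intro u v _ _ hu hv
        simp [hu, hv]
      · intro r u _ hu
        rw [Submodule.coe_smul, ← algebraMap_smul L r (u : X → L), map_smul, hu, smul_zero]
    refine hf (LinearMap.ext fun c => ?_)
    rw [hsum, LinearMap.zero_apply]
    refine Finset.sum_eq_zero fun x _ => ?_
    rw [eq_zero_of_sum_mul_equivariantFunctions ρ (fun x => f (Pi.single x 1))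
      (fun c hc => by rw [← hsum, hzero c hc]) x, zero_mul]
  let B := Module.Basis.mk hli hspan
  rw [Module.finrank_eq_nat_card_basis b, ← Module.finrank_eq_nat_card_basis B,
    Module.finrank_fintype_fun_eq_card]

/-- Write a tensor as Σ b_i ⊗ n_i with a basis b of the left factor. For fixed y, its function is an
L-combination of the independent functions α(b_i), with coefficients β(n_i)(y), so these
coefficients are determined. Equivariance is needed on one side only. -/
theorem tensorToFun_injective {X Y A B : Type*} [AddCommGroup A] [Module K A] [AddCommMonoid B]
    [Module K B] (ρ : (L ≃ₐ[K] L) →* Equiv.Perm X) {α : A →ₗ[K] X → L} {β : B →ₗ[K] Y → L}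
    (hα : Function.Injective α) (hmem : ∀ a, α a ∈ equivariantFunctions ρ)
    (hβ : Function.Injective β) : Function.Injective (tensorToFun α β) := by
  classical
  let b := Module.Basis.ofVectorSpace K A
  have hli : LinearIndependent L (fun i => α (b i)) :=
    linearIndependent_of_mem_equivariantFunctions ρ (fun i => hmem _)
      (b.linearIndependent.map' α (LinearMap.ker_eq_bot.2 hα))
  let e := (TensorProduct.equivFinsuppOfBasisLeft (N := B) b).symm
  have key : ∀ c x y, tensorToFun α β (e c) (x, y) = Finsupp.linearCombination L
      (fun i => α (b i)) (c.mapRange (fun n => β n y) (by simp)) x := by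
    intro c x y
    rw [TensorProduct.equivFinsuppOfBasisLeft_symm_apply, Finsupp.linearCombination_apply,
      Finsupp.sum_mapRange_index (by simp), Finsupp.sum, Finsupp.sum, map_sum, Finset.sum_apply,
      Finset.sum_apply]
    simp [mul_comm]
  intro z z' hz
  obtain ⟨c, rfl⟩ := e.surjective z
  obtain ⟨c', rfl⟩ := e.surjective z'
  congr 1
  ext i
  apply hβ
  ext y
  have : c.mapRange (fun n => β n y) (by simp) = c'.mapRange (fun n => β n y) (by simp) := by
    apply hli
    ext x
    rw [← key, ← key, hz]
  exact DFunLike.congr_fun this i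

end Descent

/-! ### Descent of the group ring -/

namespace MonoidAlgebra

theorem coeff_mul_eq_sum {R M : Type*} [Semiring R] [Group M] [Fintype M]
    (b c : MonoidAlgebra R M) (t : M) :
    (b * c).coeff t = ∑ s, b.coeff s * c.coeff (s⁻¹ * t) := by
  classical
  rw [coeff_mul, Finsupp.sum_fintype _ _ (by simp)]
  refine Finset.sum_congr rfl fun s _ => ?_
  rw [Finsupp.sum_fintype _ _ (by simp)]
  simp_rw [← eq_inv_mul_iff_mul_eq]
  simp

theorem sum_single_coeff {R M : Type*} [Semiring R] [Fintype M] (b : MonoidAlgebra R M) :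
    ∑ t, single t (b.coeff t) = b := by
  classical
  ext t
  simp

end MonoidAlgebra

section FixedSubalgebra

variable {K : Type u} {L : Type v} [Field K] [Field L] [Algebra K L]
  {T : Type} [Group T] [Fintype T] (ρ : (L ≃ₐ[K] L) →* MulAut T)

/-- The subalgebra of the group ring `L[T]` fixed by the semilinear action of the automorphisms of
`L/K`, which act on `L` naturally and on `T` through `ρ`. -/
def fixedSubalgebra : Subalgebra K (MonoidAlgebra L T) where
  carrier := {b | ∀ g t, b.coeff (ρ g t) = g (b.coeff t)}
  mul_mem' := by
    intro b c hb hc g t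
    rw [MonoidAlgebra.coeff_mul_eq_sum, MonoidAlgebra.coeff_mul_eq_sum, map_sum,
      ← Equiv.sum_comp (ρ g).toEquiv]
    refine Finset.sum_congr rfl fun s _ => ?_
    rw [map_mul g, ← hb, ← hc, map_mul (ρ g), map_inv]
    rfl
  add_mem' := by
    intro b c hb hc g t
    simp [hb g t, hc g t]
  algebraMap_mem' := by
    intro r g t
    classical
    rw [MonoidAlgebra.coe_algebraMap, Function.comp_apply, MonoidAlgebra.coeff_single,
      Finsupp.single_apply, Finsupp.single_apply]
    have : (1 = ρ g t) ↔ (1 = t) := by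
      rw [eq_comm, map_eq_one_iff _ (ρ g).injective, eq_comm]
    by_cases h : 1 = t
    · rw [if_pos h, if_pos (this.2 h), AlgEquiv.commutes]
    · rw [if_neg h, if_neg (mt this.1 h), map_zero]

/-- The permutation action underlying an action by automorphisms. -/
def permAction : (L ≃ₐ[K] L) →* Equiv.Perm T := (MulAut.toPerm T).comp ρ

/-- The diagonal action on pairs. -/
def permActionProd {X Y : Type*} (ρ : (L ≃ₐ[K] L) →* Equiv.Perm X)
    (ρ' : (L ≃ₐ[K] L) →* Equiv.Perm Y) : (L ≃ₐ[K] L) →* Equiv.Perm (X × Y) where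
  toFun g := (ρ g).prodCongr (ρ' g)
  map_one' := by ext <;> simp
  map_mul' g h := by ext <;> simp

/-- The coefficients of an element of the fixed subalgebra. -/
def fixedCoeff : fixedSubalgebra ρ →ₗ[K] T → L where
  toFun b := b.1.coeff
  map_add' _ _ := rfl
  map_smul' _ _ := rfl

theorem fixedCoeff_apply (b : fixedSubalgebra ρ) (t : T) : fixedCoeff ρ b t = b.1.coeff t := rfl

theorem fixedCoeff_injective : Function.Injective (fixedCoeff ρ) := fun _ _ h =>
  Subtype.ext (MonoidAlgebra.ext (DFunLike.coe_injective h))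

theorem fixedCoeff_mem (b : fixedSubalgebra ρ) :
    fixedCoeff ρ b ∈ equivariantFunctions (permAction ρ) := b.2

theorem exists_fixedCoeff_eq {c : T → L} (hc : c ∈ equivariantFunctions (permAction ρ)) :
    ∃ b, fixedCoeff ρ b = c :=
  ⟨⟨.ofCoeff (Finsupp.equivFunOnFinite.symm c), fun g t => hc g t⟩, rfl⟩

theorem fixedCoeff_mul (b c : fixedSubalgebra ρ) (t : T) :
    fixedCoeff ρ (b * c) t = ∑ s, fixedCoeff ρ b s * fixedCoeff ρ c (s⁻¹ * t) :=
  MonoidAlgebra.coeff_mul_eq_sum _ _ _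

/-- The linear identification of the fixed subalgebra with the equivariant functions. -/
def fixedEquiv : fixedSubalgebra ρ ≃ₗ[K] equivariantFunctions (permAction ρ) :=
  LinearEquiv.ofBijective ((fixedCoeff ρ).codRestrict _ (fixedCoeff_mem ρ))
    ⟨fun _ _ h => fixedCoeff_injective ρ (congrArg Subtype.val h), fun c => by
      obtain ⟨b, hb⟩ := exists_fixedCoeff_eq ρ c.2
      exact ⟨b, Subtype.ext hb⟩⟩

/-- The coefficients of a tensor over the fixed subalgebra. -/
abbrev fixedCoeff₂ : fixedSubalgebra ρ ⊗[K] fixedSubalgebra ρ →ₗ[K] T × T → L :=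
  tensorToFun (fixedCoeff ρ) (fixedCoeff ρ)

/-- The coefficients of a threefold tensor over the fixed subalgebra. -/
abbrev fixedCoeff₃ : fixedSubalgebra ρ ⊗[K] (fixedSubalgebra ρ ⊗[K] fixedSubalgebra ρ) →ₗ[K]
    T × (T × T) → L :=
  tensorToFun (fixedCoeff ρ) (fixedCoeff₂ ρ)

theorem fixedCoeff₂_mem (z : fixedSubalgebra ρ ⊗[K] fixedSubalgebra ρ) :
    fixedCoeff₂ ρ z ∈ equivariantFunctions (permActionProd (permAction ρ) (permAction ρ)) := by
  induction z with
  | zero => rw [map_zero]; exact zero_mem _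
  | add z w hz hw => rw [map_add]; exact add_mem hz hw
  | tmul a b =>
    rintro g ⟨s, t⟩
    change fixedCoeff₂ ρ (a ⊗ₜ b) (permAction ρ g s, permAction ρ g t) = _
    rw [tensorToFun_tmul, tensorToFun_tmul, fixedCoeff_mem ρ a, fixedCoeff_mem ρ b, map_mul]

theorem fixedCoeff₂_mul (z w : fixedSubalgebra ρ ⊗[K] fixedSubalgebra ρ) (t u : T) :
    fixedCoeff₂ ρ (z * w) (t, u) =
      ∑ s, ∑ r, fixedCoeff₂ ρ z (s, r) * fixedCoeff₂ ρ w (s⁻¹ * t, r⁻¹ * u) := by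
  induction z with
  | zero => simp
  | add z z' hz hz' =>
    simp only [add_mul, map_add, Pi.add_apply, hz, hz', Finset.sum_add_distrib]
  | tmul a b =>
    induction w with
    | zero => simp
    | add z z' hz hz' =>
      simp only [mul_add, map_add, Pi.add_apply, hz, hz', Finset.sum_add_distrib]
    | tmul c d =>
      simp only [Algebra.TensorProduct.tmul_mul_tmul, tensorToFun_tmul, fixedCoeff_mul,
        Finset.sum_mul_sum]
      refine Finset.sum_congr rfl fun s _ => Finset.sum_congr rfl fun r _ => ?_
      ring

/-- The antipode of the fixed subalgebra. -/
def fixedAntipode : fixedSubalgebra ρ →ₗ[K] fixedSubalgebra ρ :=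
  (fixedEquiv ρ).symm.toLinearMap ∘ₗ
    { toFun := fun b => ⟨fun t => fixedCoeff ρ b t⁻¹, fun g t => by
        rw [← fixedCoeff_mem ρ b]
        exact congrArg _ (map_inv (ρ g) t).symm⟩
      map_add' := fun b c => by ext; simp
      map_smul' := fun r b => by ext; simp }

theorem fixedCoeff_antipode (b : fixedSubalgebra ρ) (t : T) :
    fixedCoeff ρ (fixedAntipode ρ b) t = fixedCoeff ρ b t⁻¹ := by
  have : ∀ F, fixedCoeff ρ ((fixedEquiv ρ).symm F) = F.1 := by
    intro F
    conv_rhs => rw [← (fixedEquiv ρ).apply_symm_apply F]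
    rfl
  rw [fixedAntipode, LinearMap.comp_apply, LinearEquiv.coe_coe, this]
  rfl

theorem fixedCoeff_algebraMap [DecidableEq T] (r : K) (t : T) :
    fixedCoeff ρ (algebraMap K _ r) t = if t = 1 then algebraMap K L r else 0 := by
  rw [fixedCoeff_apply]
  change (algebraMap K (MonoidAlgebra L T) r).coeff t = _
  rw [MonoidAlgebra.coe_algebraMap, Function.comp_apply, MonoidAlgebra.coeff_single,
    Finsupp.single_apply]
  simp [eq_comm]

theorem fixedCoeff_one [DecidableEq T] (t : T) : fixedCoeff ρ 1 t = if t = 1 then 1 else 0 := by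
  simpa using fixedCoeff_algebraMap ρ 1 t

theorem fixedCoeff₃_assoc_tmul (w : fixedSubalgebra ρ ⊗[K] fixedSubalgebra ρ)
    (b : fixedSubalgebra ρ) (s t u : T) :
    fixedCoeff₃ ρ (TensorProduct.assoc K _ _ _ (w ⊗ₜ b)) (s, (t, u)) =
      fixedCoeff₂ ρ w (s, t) * fixedCoeff ρ b u := by
  induction w with
  | zero => rw [TensorProduct.zero_tmul, LinearEquiv.map_zero]; simp
  | add z w hz hw =>
    rw [TensorProduct.add_tmul, map_add, map_add, Pi.add_apply, hz, hw, map_add, Pi.add_apply,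
      add_mul]
  | tmul a b => simp [mul_assoc]

theorem fixedCoeff_mul_rTensor_antipode (z : fixedSubalgebra ρ ⊗[K] fixedSubalgebra ρ) (t : T) :
    fixedCoeff ρ (LinearMap.mul' K _ ((fixedAntipode ρ).rTensor _ z)) t =
      ∑ s, fixedCoeff₂ ρ z (s⁻¹, s⁻¹ * t) := by
  induction z with
  | zero => simp
  | add z w hz hw => simp only [map_add, Pi.add_apply, hz, hw, Finset.sum_add_distrib]
  | tmul a b => simp [fixedCoeff_mul, fixedCoeff_antipode]

theorem fixedCoeff_mul_lTensor_antipode (z : fixedSubalgebra ρ ⊗[K] fixedSubalgebra ρ) (t : T) :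
    fixedCoeff ρ (LinearMap.mul' K _ ((fixedAntipode ρ).lTensor _ z)) t =
      ∑ s, fixedCoeff₂ ρ z (s, t⁻¹ * s) := by
  induction z with
  | zero => simp
  | add z w hz hw => simp only [map_add, Pi.add_apply, hz, hw, Finset.sum_add_distrib]
  | tmul a b => simp [fixedCoeff_mul, fixedCoeff_antipode]

variable [FiniteDimensional K L] [IsGalois K L]

theorem finrank_fixedSubalgebra : Module.finrank K (fixedSubalgebra ρ) = Fintype.card T := by
  rw [(fixedEquiv ρ).finrank_eq, finrank_equivariantFunctions]

instance finite_fixedSubalgebra : Module.Finite K (fixedSubalgebra ρ) :=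
  Module.Finite.equiv (fixedEquiv ρ).symm

theorem fixedCoeff₂_injective : Function.Injective (fixedCoeff₂ ρ) :=
  tensorToFun_injective (permAction ρ) (fixedCoeff_injective ρ) (fixedCoeff_mem ρ)
    (fixedCoeff_injective ρ)

theorem fixedCoeff₃_injective : Function.Injective (fixedCoeff₃ ρ) :=
  tensorToFun_injective (permAction ρ) (fixedCoeff_injective ρ) (fixedCoeff_mem ρ)
    (fixedCoeff₂_injective ρ)

/-- Descent for the tensor square: tensors over the fixed subalgebra are the equivariant functions
of two variables. -/
def fixedEquiv₂ : fixedSubalgebra ρ ⊗[K] fixedSubalgebra ρ ≃ₗ[K]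
    equivariantFunctions (permActionProd (permAction ρ) (permAction ρ)) :=
  LinearEquiv.ofInjectiveOfFinrankEq ((fixedCoeff₂ ρ).codRestrict _ (fixedCoeff₂_mem ρ))
    (fun _ _ h => fixedCoeff₂_injective ρ (congrArg Subtype.val h)) (by
      rw [Module.finrank_tensorProduct, finrank_fixedSubalgebra, finrank_equivariantFunctions,
        Fintype.card_prod])

/-- The Galois group only permutes the summands, so the augmentation of a fixed element is Galois
invariant. This makes the counit K-valued. -/
theorem sum_fixedCoeff_mem (b : fixedSubalgebra ρ) :
    ∑ t, fixedCoeff ρ b t ∈ LinearMap.range (Algebra.linearMap K L) := by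
  rw [LinearMap.mem_range]
  refine (IsGalois.mem_range_algebraMap_iff_fixed _).2 fun g => ?_
  rw [map_sum]
  conv_rhs => rw [← Equiv.sum_comp (permAction ρ g)]
  exact Finset.sum_congr rfl fun t _ => (fixedCoeff_mem ρ b g t).symm

/-- The counit of the fixed subalgebra. -/
def fixedCounit : fixedSubalgebra ρ →ₗ[K] K :=
  (LinearEquiv.ofInjective (Algebra.linearMap K L)
    (FaithfulSMul.algebraMap_injective K L)).symm.toLinearMap ∘ₗ
    LinearMap.codRestrict (LinearMap.range (Algebra.linearMap K L))
      { toFun := fun b => ∑ t, fixedCoeff ρ b t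
        map_add' := fun b c => by simp [Finset.sum_add_distrib]
        map_smul' := fun r b => by simp [Finset.smul_sum] }
      (sum_fixedCoeff_mem ρ)

theorem algebraMap_fixedCounit (b : fixedSubalgebra ρ) :
    algebraMap K L (fixedCounit ρ b) = ∑ t, fixedCoeff ρ b t := by
  have := LinearEquiv.apply_symm_apply (LinearEquiv.ofInjective (Algebra.linearMap K L)
    (FaithfulSMul.algebraMap_injective K L)) ⟨_, sum_fixedCoeff_mem ρ b⟩
  exact congrArg Subtype.val this

theorem fixedCoeff_rTensor_counit (z : fixedSubalgebra ρ ⊗[K] fixedSubalgebra ρ) (t : T) :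
    fixedCoeff ρ (TensorProduct.lid K _ ((fixedCounit ρ).rTensor _ z)) t =
      ∑ s, fixedCoeff₂ ρ z (s, t) := by
  induction z with
  | zero => simp
  | add z w hz hw => simp only [map_add, Pi.add_apply, hz, hw, Finset.sum_add_distrib]
  | tmul a b =>
    rw [LinearMap.rTensor_tmul, TensorProduct.lid_tmul, map_smul, Pi.smul_apply, Algebra.smul_def,
      algebraMap_fixedCounit, Finset.sum_mul]
    simp

theorem fixedCoeff_lTensor_counit (z : fixedSubalgebra ρ ⊗[K] fixedSubalgebra ρ) (t : T) :
    fixedCoeff ρ (TensorProduct.rid K _ ((fixedCounit ρ).lTensor _ z)) t =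
      ∑ s, fixedCoeff₂ ρ z (t, s) := by
  induction z with
  | zero => simp
  | add z w hz hw => simp only [map_add, Pi.add_apply, hz, hw, Finset.sum_add_distrib]
  | tmul a b =>
    rw [LinearMap.lTensor_tmul, TensorProduct.rid_tmul, map_smul, Pi.smul_apply, Algebra.smul_def,
      algebraMap_fixedCounit, Finset.sum_mul]
    simp [mul_comm]

variable [DecidableEq T]

/-- The comultiplication of the fixed subalgebra. -/
def fixedComul : fixedSubalgebra ρ →ₗ[K] fixedSubalgebra ρ ⊗[K] fixedSubalgebra ρ :=
  (fixedEquiv₂ ρ).symm.toLinearMap ∘ₗ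
    { toFun := fun b => ⟨fun z => if z.1 = z.2 then fixedCoeff ρ b z.1 else 0, by
        rintro g ⟨s, t⟩
        change (if permAction ρ g s = permAction ρ g t then fixedCoeff ρ b (permAction ρ g s) else 0)
          = g (if s = t then fixedCoeff ρ b s else 0)
        simp only [(permAction ρ g).injective.eq_iff, fixedCoeff_mem ρ b g]
        split_ifs <;> simp⟩
      map_add' := fun b c => by
        ext z
        by_cases h : z.1 = z.2 <;> simp [h]
      map_smul' := fun r b => by
        ext z
        by_cases h : z.1 = z.2 <;> simp [h] }

theorem fixedCoeff₂_comul (b : fixedSubalgebra ρ) (s t : T) :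
    fixedCoeff₂ ρ (fixedComul ρ b) (s, t) = if s = t then fixedCoeff ρ b s else 0 := by
  have : ∀ F, fixedCoeff₂ ρ ((fixedEquiv₂ ρ).symm F) = F.1 := by
    intro F
    conv_rhs => rw [← (fixedEquiv₂ ρ).apply_symm_apply F]
    rfl
  rw [fixedComul, LinearMap.comp_apply, LinearEquiv.coe_coe, this]
  rfl

theorem fixedCoeff₃_lTensor_comul (z : fixedSubalgebra ρ ⊗[K] fixedSubalgebra ρ) (s t u : T) :
    fixedCoeff₃ ρ ((fixedComul ρ).lTensor _ z) (s, (t, u)) =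
      if t = u then fixedCoeff₂ ρ z (s, t) else 0 := by
  induction z with
  | zero => simp
  | add z w hz hw => simp only [map_add, Pi.add_apply, hz, hw]; split_ifs <;> simp
  | tmul a b => simp [fixedCoeff₂_comul]

theorem fixedCoeff₃_rTensor_comul (z : fixedSubalgebra ρ ⊗[K] fixedSubalgebra ρ) (s t u : T) :
    fixedCoeff₃ ρ (TensorProduct.assoc K _ _ _ ((fixedComul ρ).rTensor _ z)) (s, (t, u)) =
      if s = t then fixedCoeff₂ ρ z (s, u) else 0 := by
  induction z with
  | zero => simp
  | add z w hz hw => simp only [map_add, Pi.add_apply, hz, hw]; split_ifs <;> simp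
  | tmul a b => simp [fixedCoeff₃_assoc_tmul, fixedCoeff₂_comul]

instance coalgebra_fixedSubalgebra : Coalgebra K (fixedSubalgebra ρ) where
  comul := fixedComul ρ
  counit := fixedCounit ρ
  coassoc := by
    -- As functions of three variables, both iterated comultiplications are the coefficient function
    -- placed on s = t = u.
    refine LinearMap.ext fun b => fixedCoeff₃_injective ρ ?_
    ext ⟨s, t, u⟩
    simp only [LinearMap.comp_apply, LinearEquiv.coe_coe]
    rw [fixedCoeff₃_rTensor_comul, fixedCoeff₃_lTensor_comul, fixedCoeff₂_comul,
      fixedCoeff₂_comul]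
    grind
  rTensor_counit_comp_comul := by
    refine LinearMap.ext fun b => (TensorProduct.lid K _).injective (fixedCoeff_injective ρ ?_)
    ext t
    simp only [LinearMap.comp_apply]
    rw [fixedCoeff_rTensor_counit]
    simp [fixedCoeff₂_comul]
  lTensor_counit_comp_comul := by
    refine LinearMap.ext fun b => (TensorProduct.rid K _).injective (fixedCoeff_injective ρ ?_)
    ext t
    simp only [LinearMap.comp_apply]
    rw [fixedCoeff_lTensor_counit]
    simp [fixedCoeff₂_comul]

instance bialgebra_fixedSubalgebra : Bialgebra K (fixedSubalgebra ρ) :=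
  Bialgebra.mk' K (fixedSubalgebra ρ)
    (by
      apply FaithfulSMul.algebraMap_injective K L
      change algebraMap K L (fixedCounit ρ 1) = _
      simp [algebraMap_fixedCounit, fixedCoeff_one])
    (by
      intro b c
      apply FaithfulSMul.algebraMap_injective K L
      change algebraMap K L (fixedCounit ρ (b * c)) =
        algebraMap K L (fixedCounit ρ b * fixedCounit ρ c)
      simp only [map_mul, algebraMap_fixedCounit, fixedCoeff_mul]
      rw [Finset.sum_comm, Finset.sum_mul]
      refine Finset.sum_congr rfl fun s _ => ?_
      rw [← Finset.mul_sum, ← Equiv.sum_comp (Equiv.mulLeft s⁻¹) (fixedCoeff ρ c)]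
      rfl)
    (by
      apply fixedCoeff₂_injective ρ
      ext ⟨s, t⟩
      change fixedCoeff₂ ρ (fixedComul ρ 1) (s, t) = _
      rw [fixedCoeff₂_comul, Algebra.TensorProduct.one_def, tensorToFun_tmul]
      simp only [fixedCoeff_one]
      grind)
    (by
      intro b c
      apply fixedCoeff₂_injective ρ
      ext ⟨s, t⟩
      change fixedCoeff₂ ρ (fixedComul ρ (b * c)) (s, t) =
        fixedCoeff₂ ρ (fixedComul ρ b * fixedComul ρ c) (s, t)
      rw [fixedCoeff₂_mul]
      simp only [fixedCoeff₂_comul, fixedCoeff_mul, ite_mul, zero_mul, mul_ite, mul_zero]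
      by_cases h : s = t
      · subst h
        rw [if_pos rfl]
        refine Finset.sum_congr rfl fun x _ => ?_
        rw [Finset.sum_eq_single x (fun y _ hy => by simp [hy.symm]) (by simp)]
        simp
      · rw [if_neg h]
        refine (Finset.sum_eq_zero fun x _ => Finset.sum_eq_zero fun y _ => ?_).symm
        split_ifs with h1 h2
        · subst h2
          exact absurd (mul_left_cancel h1) h
        · rfl
        · rfl)

instance hopfAlgebra_fixedSubalgebra : HopfAlgebra K (fixedSubalgebra ρ) where
  antipode := fixedAntipode ρ
  mul_antipode_rTensor_comul := by
    refine LinearMap.ext fun b => fixedCoeff_injective ρ ?_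
    ext t
    change fixedCoeff ρ (LinearMap.mul' K _ ((fixedAntipode ρ).rTensor _ (fixedComul ρ b))) t =
      fixedCoeff ρ (algebraMap K _ (fixedCounit ρ b)) t
    rw [fixedCoeff_mul_rTensor_antipode, fixedCoeff_algebraMap, algebraMap_fixedCounit]
    simp only [fixedCoeff₂_comul, left_eq_mul]
    split_ifs
    · exact Equiv.sum_comp (Equiv.inv T) _
    · simp
  mul_antipode_lTensor_comul := by
    refine LinearMap.ext fun b => fixedCoeff_injective ρ ?_
    ext t
    change fixedCoeff ρ (LinearMap.mul' K _ ((fixedAntipode ρ).lTensor _ (fixedComul ρ b))) t =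
      fixedCoeff ρ (algebraMap K _ (fixedCounit ρ b)) t
    rw [fixedCoeff_mul_lTensor_antipode, fixedCoeff_algebraMap, algebraMap_fixedCounit]
    simp only [fixedCoeff₂_comul, right_eq_mul, inv_eq_one]
    split_ifs <;> simp

instance isCocomm_fixedSubalgebra : Coalgebra.IsCocomm K (fixedSubalgebra ρ) where
  comm_comp_comul := by
    refine LinearMap.ext fun b => fixedCoeff₂_injective ρ ?_
    have hcomm : ∀ (z : fixedSubalgebra ρ ⊗[K] fixedSubalgebra ρ) (s t : T),
        fixedCoeff₂ ρ (TensorProduct.comm K _ _ z) (s, t) = fixedCoeff₂ ρ z (t, s) := by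
      intro z s t
      induction z with
      | zero => simp
      | add z w hz hw => simp only [map_add, Pi.add_apply, hz, hw]
      | tmul a b => simp [mul_comm]
    ext ⟨s, t⟩
    change fixedCoeff₂ ρ (TensorProduct.comm K _ _ (fixedComul ρ b)) (s, t) =
      fixedCoeff₂ ρ (fixedComul ρ b) (s, t)
    rw [hcomm, fixedCoeff₂_comul, fixedCoeff₂_comul]
    grind

end FixedSubalgebra

/-! ### The Hopf Galois structure of a crossed bijection. -/

section DescentStructure

variable {K : Type u} {L : Type v} [Field K] [Field L] [Algebra K L]
  {T : Type} [Group T] [Fintype T] (ρ : (L ≃ₐ[K] L) →* MulAut T) (β : T ≃ (L ≃ₐ[K] L))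

/-- The `K`-linear endomorphism `a ↦ ∑ c_t β(t)(a)` of `L`. -/
def twistedAction : fixedSubalgebra ρ →ₗ[K] Module.End K L where
  toFun b := ∑ t, LinearMap.mulLeft K (fixedCoeff ρ b t) ∘ₗ (β t).toLinearMap
  map_add' b c := by
    ext a
    simp [add_mul, Finset.sum_add_distrib]
  map_smul' r b := by
    ext a
    simp [Finset.smul_sum]

theorem twistedAction_apply (b : fixedSubalgebra ρ) (a : L) :
    twistedAction ρ β b a = ∑ t, fixedCoeff ρ b t * β t a := by
  simp [twistedAction]

theorem twistedAction_one [DecidableEq T] (h1 : β 1 = 1) : twistedAction ρ β 1 = 1 := by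
  ext a
  simp [twistedAction_apply, fixedCoeff_one, h1]

theorem twistedAction_mul (hβ : ∀ t u, β (t * ρ (β t) u) = β t * β u)
    (b c : fixedSubalgebra ρ) :
    twistedAction ρ β (b * c) = twistedAction ρ β b * twistedAction ρ β c := by
  ext a
  rw [Module.End.mul_apply]
  simp only [twistedAction_apply, fixedCoeff_mul, map_sum, Finset.sum_mul]
  conv_lhs => rw [Finset.sum_comm]
  conv_rhs => rw [Finset.sum_comm]
  refine Finset.sum_congr rfl fun s _ => ?_
  -- The substitution t ↦ s·ρ(β s)(t) lets equivariance pull β(s) out of the coefficient of c, and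
  -- the crossed condition splits the automorphism into β(s)β(t).
  rw [← Equiv.sum_comp ((ρ (β s)).toEquiv.trans (Equiv.mulLeft s))]
  refine Finset.sum_congr rfl fun t _ => ?_
  change _ * fixedCoeff ρ c (s⁻¹ * (s * ρ (β s) t)) * β (s * ρ (β s) t) a = _
  rw [inv_mul_cancel_left, hβ, AlgEquiv.mul_apply, map_mul (β s), mul_assoc,
    show fixedCoeff ρ c (ρ (β s) t) = β s (fixedCoeff ρ c t) from fixedCoeff_mem ρ c (β s) t]

theorem lift_twistedAction (z : fixedSubalgebra ρ ⊗[K] fixedSubalgebra ρ) (a b : L) :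
    TensorProduct.lift ((LinearMap.mul K L).compl₁₂
      (LinearMap.applyₗ a ∘ₗ twistedAction ρ β) (LinearMap.applyₗ b ∘ₗ twistedAction ρ β)) z =
      ∑ s, ∑ t, fixedCoeff₂ ρ z (s, t) * (β s a * β t b) := by
  induction z with
  | zero => simp
  | add z w hz hw => simp only [map_add, Pi.add_apply, hz, hw, Finset.sum_add_distrib, add_mul]
  | tmul c d =>
    simp only [TensorProduct.lift.tmul, LinearMap.compl₁₂_apply, LinearMap.comp_apply,
      LinearMap.applyₗ_apply_apply, LinearMap.mul_apply', twistedAction_apply, tensorToFun_tmul,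
      Finset.sum_mul_sum]
    refine Finset.sum_congr rfl fun s _ => Finset.sum_congr rfl fun t _ => ?_
    ring

/-- The map `L ⊗ H → End_K(L)` attached to the twisted action. -/
def twistedGaloisMap : L ⊗[K] fixedSubalgebra ρ →ₗ[K] Module.End K L :=
  TensorProduct.lift ((LinearMap.mul K (Module.End K L)).compl₁₂
    (LinearMap.mul K L) (twistedAction ρ β))

theorem twistedGaloisMap_apply (z : L ⊗[K] fixedSubalgebra ρ) (a : L) :
    twistedGaloisMap ρ β z a =
      ∑ t, tensorToFun (fixedCoeff ρ) (LinearMap.pi fun _ : Unit => LinearMap.id (R := K) (M := L))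
        (TensorProduct.comm K _ _ z) (t, ()) * β t a := by
  induction z with
  | zero => simp
  | add z w hz hw =>
    simp only [map_add, LinearMap.add_apply, Pi.add_apply, hz, hw, Finset.sum_add_distrib, add_mul]
  | tmul l b =>
    simp [twistedGaloisMap, twistedAction_apply]
    refine Finset.sum_congr rfl fun t _ => ?_
    ring

variable [FiniteDimensional K L] [IsGalois K L]

/-- An element of L ⊗ H acts as a combination of the distinct automorphisms β(t), so Dedekind gives
injectivity. Both sides have K-dimension [L:K]², since |T| = [L:K]. -/
theorem twistedGaloisMap_bijective : Function.Bijective (twistedGaloisMap ρ β) := by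
  have hinj : Function.Injective (twistedGaloisMap ρ β) := by
    rw [injective_iff_map_eq_zero]
    intro z hz
    apply (TensorProduct.comm K _ _).injective
    rw [map_zero]
    apply tensorToFun_injective (permAction ρ) (fixedCoeff_injective ρ) (fixedCoeff_mem ρ)
      (β := LinearMap.pi fun _ : Unit => LinearMap.id (R := K) (M := L))
      (fun x y h => congrFun h ())
    rw [map_zero]
    ext ⟨t, _⟩
    have := eq_zero_of_sum_mul_algEquiv_eq_zero (K := K) (fun g =>
      tensorToFun (fixedCoeff ρ) (LinearMap.pi fun _ : Unit => LinearMap.id (R := K) (M := L))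
        (TensorProduct.comm K _ _ z) (β.symm g, ())) (fun a => ?_) (β t)
    · simpa using this
    · rw [← LinearMap.zero_apply (σ₁₂ := RingHom.id K) a, ← hz, twistedGaloisMap_apply,
        ← Equiv.sum_comp β]
      simp
  refine ⟨hinj, (LinearMap.injective_iff_surjective_of_finrank_eq_finrank ?_).1 hinj⟩
  rw [Module.finrank_tensorProduct, finrank_fixedSubalgebra, Module.finrank_linearMap,
    Fintype.card_congr β, ← Nat.card_eq_fintype_card, IsGalois.card_aut_eq_finrank]

/-- The Hopf Galois structure on `L/K` obtained by descent from the group ring of `T`, for a group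
`T` with an action `ρ` of the Galois group and a crossed bijection `β`. -/
def descentStructure [DecidableEq T] (h1 : β 1 = 1)
    (hβ : ∀ t u, β (t * ρ (β t) u) = β t * β u) : HopfGaloisStructure K L where
  H := fixedSubalgebra ρ
  finite := finite_fixedSubalgebra ρ
  cocomm := isCocomm_fixedSubalgebra ρ
  act := AlgHom.ofLinearMap (twistedAction ρ β) (twistedAction_one ρ β h1)
    (twistedAction_mul ρ β hβ)
  act_one b := by
    change twistedAction ρ β b 1 = algebraMap K L (fixedCounit ρ b)
    simp [twistedAction_apply, algebraMap_fixedCounit]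
  act_mul h a b := by
    change twistedAction ρ β h (a * b) = TensorProduct.lift ((LinearMap.mul K L).compl₁₂
      (LinearMap.applyₗ a ∘ₗ twistedAction ρ β) (LinearMap.applyₗ b ∘ₗ twistedAction ρ β))
      (fixedComul ρ h)
    rw [lift_twistedAction, twistedAction_apply]
    simp [fixedCoeff₂_comul]
  galois := twistedGaloisMap_bijective ρ β

end DescentStructure

/-! ### Coefficients of comultiplications in the group ring -/

section Comul

variable {K : Type u} {L : Type v} [Field K] [Field L] [Algebra K L] {T : Type}

/-- The `t`-th coefficient. -/
def coeffFunctional (t : T) : MonoidAlgebra L T →ₗ[L] L where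
  toFun b := b.coeff t
  map_add' _ _ := rfl
  map_smul' _ _ := rfl

/-- The coefficient at `(s, t)` of an element of `L[T] ⊗ L[T]`. -/
def coeffFunctional₂ (s t : T) : MonoidAlgebra L T ⊗[L] MonoidAlgebra L T →ₗ[L] L :=
  TensorProduct.lift ((LinearMap.mul L L).compl₁₂ (coeffFunctional s) (coeffFunctional t))

theorem coeffFunctional₂_tmul (s t : T) (b c : MonoidAlgebra L T) :
    coeffFunctional₂ s t (b ⊗ₜ c) = b.coeff s * c.coeff t := rfl

theorem comul_eq_sum [Fintype T] (b : MonoidAlgebra L T) :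
    Coalgebra.comul (R := L) b =
      ∑ t, b.coeff t • (MonoidAlgebra.single t (1 : L) ⊗ₜ[L] MonoidAlgebra.single t (1 : L)) := by
  conv_lhs => rw [← MonoidAlgebra.sum_single_coeff b]
  rw [map_sum]
  refine Finset.sum_congr rfl fun t _ => ?_
  rw [← mul_one (b.coeff t), ← smul_eq_mul, ← MonoidAlgebra.smul_single, map_smul]
  simp

theorem coeffFunctional₂_comul [Fintype T] [DecidableEq T] (b : MonoidAlgebra L T) (s t : T) :
    coeffFunctional₂ s t (Coalgebra.comul (R := L) b) = if s = t then b.coeff s else 0 := by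
  rw [comul_eq_sum, map_sum]
  simp [coeffFunctional₂_tmul, Finsupp.single_apply]
  grind

theorem eq_sum_coeffFunctional₂ [Fintype T] (z : MonoidAlgebra L T ⊗[L] MonoidAlgebra L T) :
    z = ∑ s, ∑ t, coeffFunctional₂ s t z •
      (MonoidAlgebra.single s (1 : L) ⊗ₜ[L] MonoidAlgebra.single t (1 : L)) := by
  induction z with
  | zero => simp
  | add z w hz hw =>
    simp only [map_add, add_smul, Finset.sum_add_distrib]
    rw [← hz, ← hw]
  | tmul b c =>
    conv_lhs => rw [← MonoidAlgebra.sum_single_coeff b, ← MonoidAlgebra.sum_single_coeff c]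
    rw [TensorProduct.sum_tmul]
    refine Finset.sum_congr rfl fun s _ => ?_
    rw [TensorProduct.tmul_sum]
    refine Finset.sum_congr rfl fun t _ => ?_
    rw [coeffFunctional₂_tmul, mul_smul, ← TensorProduct.tmul_smul, TensorProduct.smul_tmul']
    simp

theorem coeffFunctional₂_ext [Fintype T] {z w : MonoidAlgebra L T ⊗[L] MonoidAlgebra L T}
    (h : ∀ s t, coeffFunctional₂ s t z = coeffFunctional₂ s t w) : z = w := by
  rw [eq_sum_coeffFunctional₂ z, eq_sum_coeffFunctional₂ w]
  simp only [h]

theorem coeffFunctional₂_mapOfCompatibleSMul {H : Type*} [AddCommMonoid H] [Module K H]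
    (φ : H →ₗ[K] MonoidAlgebra L T) (α : H →ₗ[K] T → L) (hα : ∀ h t, α h t = (φ h).coeff t)
    (z : H ⊗[K] H) (s t : T) :
    coeffFunctional₂ s t (TensorProduct.mapOfCompatibleSMul L K K (MonoidAlgebra L T)
      (MonoidAlgebra L T) (TensorProduct.map φ φ z)) = tensorToFun α α z (s, t) := by
  induction z with
  | zero => simp
  | add z w hz hw => simp only [map_add, Pi.add_apply, hz, hw]
  | tmul a b => simp [coeffFunctional₂_tmul, hα]

end Comul

/-! ### Regular subgroups normalized by the translations -/

section RegularSubgroup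

variable {p n : ℕ}

theorem translation_apply (g x : FpVec p n) : translation p n g x = g + x := rfl

theorem translation_inv (g : FpVec p n) : (translation p n g)⁻¹ = translation p n (-g) := by
  rw [inv_eq_iff_mul_eq_one]
  ext x : 1
  exact add_neg_cancel_left g x

theorem translation_add (g h : FpVec p n) :
    translation p n (g + h) = translation p n g * translation p n h := by
  ext x : 1
  exact add_assoc g h x

theorem translation_conj_apply (g x : FpVec p n) (t : AffGroup p n) :
    (translation p n g * t * (translation p n g)⁻¹) x = g + t (-g + x) := by
  rw [translation_inv]
  rfl

/-- The subgroup `T` is normalized by the translations. -/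
def IsNormalizedByTranslations (T : Subgroup (AffGroup p n)) : Prop :=
  ∀ g : FpVec p n, ∀ t ∈ T, translation p n g * t * (translation p n g)⁻¹ ∈ T

/-- Conjugation with a translation, on a subgroup normalized by the translations. -/
def translationConj {T : Subgroup (AffGroup p n)} (hT : IsNormalizedByTranslations T) :
    Multiplicative (FpVec p n) →* MulAut T where
  toFun g :=
    { toFun := fun t => ⟨_, hT g.toAdd t t.2⟩
      invFun := fun t => ⟨_, hT (-g.toAdd) t t.2⟩
      left_inv := fun t => Subtype.ext (by
        simp only [translation_inv, neg_neg]
        rw [← translation_inv]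
        group)
      right_inv := fun t => Subtype.ext (by
        simp only [translation_inv, neg_neg]
        rw [← translation_inv]
        group)
      map_mul' := fun s t => Subtype.ext (by
        simp only [Subgroup.coe_mul]
        group) }
  map_one' := by
    ext t : 2
    change translation p n 0 * (t : AffGroup p n) * (translation p n 0)⁻¹ = t
    have : translation p n 0 = 1 := by
      ext x : 1
      simp [translation_apply]
    simp [this]
  map_mul' g h := by
    ext t : 2
    change translation p n (g.toAdd + h.toAdd) * (t : AffGroup p n) *
      (translation p n (g.toAdd + h.toAdd))⁻¹ = translation p n g.toAdd *
        (translation p n h.toAdd * t * (translation p n h.toAdd)⁻¹) * (translation p n g.toAdd)⁻¹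
    rw [translation_add]
    group

theorem coe_translationConj {T : Subgroup (AffGroup p n)} (hT : IsNormalizedByTranslations T)
    (g : Multiplicative (FpVec p n)) (t : T) :
    (translationConj hT g t : AffGroup p n) =
      translation p n g.toAdd * t * (translation p n g.toAdd)⁻¹ := rfl

theorem inv_apply_eq_iff (t : AffGroup p n) (x y : FpVec p n) : t⁻¹ x = y ↔ t y = x := by
  rw [AffineEquiv.inv_def, AffineEquiv.symm_apply_eq, eq_comm]

theorem translation_conj_inv_apply_zero (g : FpVec p n) (t : AffGroup p n) :
    (translation p n g * t * (translation p n g)⁻¹)⁻¹ 0 = g + t⁻¹ (-g) := by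
  have : (translation p n g * t * (translation p n g)⁻¹)⁻¹ =
      translation p n g * t⁻¹ * (translation p n g)⁻¹ := by group
  rw [this, translation_conj_apply, add_zero]

/-- The bijection `t ↦ t⁻¹(0)` of a regular subgroup with the vector space. -/
def regularEquiv {T : Subgroup (AffGroup p n)} (hT : IsRegularSubgroup T) : T ≃ FpVec p n :=
  Equiv.ofBijective (fun t => (t⁻¹ : AffGroup p n) 0) (by
    constructor
    · intro s t hst
      have hs := (inv_apply_eq_iff (s : AffGroup p n) 0 _).1 rfl
      have ht := (inv_apply_eq_iff (t : AffGroup p n) 0 _).1 rfl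
      simp only at hst
      rw [hst] at hs
      exact Subtype.ext ((hT _ _).unique ⟨s.2, hs⟩ ⟨t.2, ht⟩)
    · intro x
      obtain ⟨t, ⟨ht, hx⟩, -⟩ := hT x 0
      exact ⟨⟨t, ht⟩, (inv_apply_eq_iff t 0 x).2 hx⟩)

theorem regularEquiv_apply {T : Subgroup (AffGroup p n)} (hT : IsRegularSubgroup T) (t : T) :
    regularEquiv hT t = (t⁻¹ : AffGroup p n) 0 := rfl

/-- With g = t⁻¹(0) and ᵍu the conjugate of u, (t·ᵍu)⁻¹(0) = (ᵍu)⁻¹(g) = g + u⁻¹(-g + g). This is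
the crossed condition that makes the action on L multiplicative. -/
theorem regularEquiv_mul_translationConj {T : Subgroup (AffGroup p n)} (hT : IsRegularSubgroup T)
    (hN : IsNormalizedByTranslations T) (t u : T) :
    regularEquiv hT (t * translationConj hN (.ofAdd (regularEquiv hT t)) u) =
      regularEquiv hT t + regularEquiv hT u := by
  set g := regularEquiv hT t with hg
  rw [regularEquiv_apply hT (t * _), Subgroup.coe_mul, coe_translationConj, mul_inv_rev]
  change (translation p n g * (u : AffGroup p n) * (translation p n g)⁻¹)⁻¹
    ((t⁻¹ : AffGroup p n) 0) = _
  rw [← regularEquiv_apply hT t, ← hg]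
  have : (translation p n g * (u : AffGroup p n) * (translation p n g)⁻¹)⁻¹ =
      translation p n g * (u : AffGroup p n)⁻¹ * (translation p n g)⁻¹ := by group
  rw [this, translation_conj_apply, neg_add_cancel]
  rfl

end RegularSubgroup

/-! ### Regular subgroups versus Hopf Galois structures. -/

section Correspondence

variable {K : Type u} {L : Type v} [Field K] [Field L] [Algebra K L] {p n : ℕ}
  (σ : Multiplicative (FpVec p n) ≃* (L ≃ₐ[K] L)) {T : Subgroup (AffGroup p n)}

/-- The action of the Galois group on a subgroup normalized by the translations. -/
def galoisConj (hN : IsNormalizedByTranslations T) : (L ≃ₐ[K] L) →* MulAut T :=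
  (translationConj hN).comp σ.symm.toMonoidHom

/-- The bijection `t ↦ σ(t⁻¹(0))` of a regular subgroup with the Galois group. -/
def galoisEquiv (hT : IsRegularSubgroup T) : T ≃ (L ≃ₐ[K] L) :=
  (regularEquiv hT).trans (Multiplicative.ofAdd.trans σ.toEquiv)

theorem galoisEquiv_apply (hT : IsRegularSubgroup T) (t : T) :
    galoisEquiv σ hT t = σ (.ofAdd ((t⁻¹ : AffGroup p n) 0)) := rfl

theorem galoisEquiv_one (hT : IsRegularSubgroup T) : galoisEquiv σ hT 1 = 1 := by
  rw [galoisEquiv_apply]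
  simp

theorem galoisEquiv_mul (hT : IsRegularSubgroup T) (hN : IsNormalizedByTranslations T) (t u : T) :
    galoisEquiv σ hT (t * galoisConj σ hN (galoisEquiv σ hT t) u) =
      galoisEquiv σ hT t * galoisEquiv σ hT u := by
  have : galoisConj σ hN (galoisEquiv σ hT t) u =
      translationConj hN (.ofAdd (regularEquiv hT t)) u := by
    simp [galoisConj, galoisEquiv]
  rw [this]
  change σ (.ofAdd (regularEquiv hT _)) = σ (.ofAdd (regularEquiv hT _)) *
    σ (.ofAdd (regularEquiv hT _))
  rw [regularEquiv_mul_translationConj, ofAdd_add, map_mul]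

theorem coe_galoisConj (hN : IsNormalizedByTranslations T) (g : FpVec p n) (t : T) :
    (galoisConj σ hN (σ (.ofAdd g)) t : AffGroup p n) =
      translation p n g * t * (translation p n g)⁻¹ := by
  simp [galoisConj, coe_translationConj]

/-- Letting g vary, the right side contains every value of t⁻¹. Thus t is determined by the Galois
action on T together with the bijection to the Galois group. -/
theorem galoisEquiv_galoisConj (hT : IsRegularSubgroup T) (hN : IsNormalizedByTranslations T)
    (g : FpVec p n) (t : T) :
    galoisEquiv σ hT (galoisConj σ hN (σ (.ofAdd g)) t) =
      σ (.ofAdd (g + (t⁻¹ : AffGroup p n) (-g))) := by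
  rw [galoisEquiv_apply, coe_galoisConj, translation_conj_inv_apply_zero]

theorem finite_of_isRegularSubgroup [NeZero p] (hT : IsRegularSubgroup T) : Finite T :=
  Finite.of_equiv _ (regularEquiv hT).symm

/-- Fixed elements of the group ring, in terms of conjugation with translations. -/
theorem forall_conj_iff (hN : IsNormalizedByTranslations T) (c : T → L) :
    (∀ (g : FpVec p n) (t t' : T),
        (t' : AffGroup p n) = translation p n g * (t : AffGroup p n) * (translation p n g)⁻¹ →
          c t' = σ (Multiplicative.ofAdd g) (c t)) ↔
      c ∈ equivariantFunctions (permAction (galoisConj σ hN)) := by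
  constructor
  · intro h γ t
    have := h (σ.symm γ).toAdd t (galoisConj σ hN γ t) rfl
    rw [ofAdd_toAdd, MulEquiv.apply_symm_apply] at this
    exact this
  · intro h g t t' ht
    have h1 := h (σ (.ofAdd g)) t
    have h2 : t' = galoisConj σ hN (σ (.ofAdd g)) t :=
      Subtype.ext (ht.trans (coe_galoisConj σ hN g t).symm)
    rw [h2]
    exact h1

namespace HopfGaloisStructure

/-- The coefficients of the image of an element of the Hopf algebra in the group ring. -/
def coeffMap {H : Type v} [Ring H] [Algebra K H] (φ : H →ₐ[K] MonoidAlgebra L T) :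
    H →ₗ[K] T → L where
  toFun h := (φ h).coeff
  map_add' a b := by
    ext t
    simp
  map_smul' r a := by
    ext t
    simp

theorem coeffMap_injective {H : Type v} [Ring H] [Algebra K H]
    {φ : H →ₐ[K] MonoidAlgebra L T} (hφ : Function.Injective φ) :
    Function.Injective (coeffMap φ) := fun _ _ h =>
  hφ (MonoidAlgebra.ext (DFunLike.coe_injective h))

variable [NeZero p] [FiniteDimensional K L]

/-- The bijections with the Galois group identify T with T'. The isomorphism makes this
identification respect the Galois actions, and an element is recovered from those data. Applying it
to both directions of the isomorphism yields equality. -/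
theorem le_of_iso {T' : Subgroup (AffGroup p n)} (hT : IsRegularSubgroup T)
    (hT' : IsRegularSubgroup T') {S S' : HopfGaloisStructure K L} (h : S.ArisesFrom σ T)
    (h' : S'.ArisesFrom σ T') (hS : S.Iso S') : T ≤ T' := by
  classical
  have := finite_of_isRegularSubgroup hT
  let _ := Fintype.ofFinite T
  have := finite_of_isRegularSubgroup hT'
  let _ := Fintype.ofFinite T'
  obtain ⟨hN, φ, -, hrange, -, -, hact⟩ := h
  obtain ⟨hN', φ', -, hrange', -, -, hact'⟩ := h'
  obtain ⟨f, hf⟩ := hS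
  -- Corresponding elements act by the same operator on L, so Dedekind equates their coefficients at
  -- each automorphism γ.
  have hcoeff : ∀ x γ, (φ x).coeff ((galoisEquiv σ hT).symm γ) =
      (φ' (f x)).coeff ((galoisEquiv σ hT').symm γ) := by
    intro x γ
    rw [← sub_eq_zero]
    refine eq_zero_of_sum_mul_algEquiv_eq_zero (K := K)
      (fun γ => (φ x).coeff ((galoisEquiv σ hT).symm γ) -
        (φ' (f x)).coeff ((galoisEquiv σ hT').symm γ)) (fun a => ?_) γ
    simp only [sub_mul, Finset.sum_sub_distrib]
    rw [sub_eq_zero, ← Equiv.sum_comp (galoisEquiv σ hT), ← Equiv.sum_comp (galoisEquiv σ hT')]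
    simp only [Equiv.symm_apply_apply]
    have := LinearMap.congr_fun (hf x) a
    rw [hact, hact', Finsupp.sum_fintype _ _ (by simp), Finsupp.sum_fintype _ _ (by simp)] at this
    exact this.symm
  have hequiv : ∀ t : T, ∀ γ, galoisEquiv σ hT (galoisConj σ hN γ t) = galoisEquiv σ hT'
      (galoisConj σ hN' γ ((galoisEquiv σ hT').symm (galoisEquiv σ hT t))) := by
    intro t γ
    rw [← Equiv.symm_apply_eq]
    -- Equivariant functions separate points of T', and each of them is the coefficient function of
    -- some φ'(f x), which `hcoeff` transfers to T.
    refine eq_of_forall_equivariantFunctions (permAction (galoisConj σ hN')) fun c hc => ?_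
    obtain ⟨y, hy⟩ := (hrange' (.ofCoeff (Finsupp.equivFunOnFinite.symm c))).2
      ((forall_conj_iff σ hN' c).2 hc)
    have hcy : ∀ t', c t' = (φ' y).coeff t' := fun t' => by rw [hy]; rfl
    obtain ⟨x, rfl⟩ := f.toEquiv.surjective y
    have hx := (forall_conj_iff σ hN _).1 ((hrange (φ x)).1 ⟨x, rfl⟩) γ t
    have e1 : c ((galoisEquiv σ hT').symm (galoisEquiv σ hT (galoisConj σ hN γ t))) =
        (φ x).coeff (galoisConj σ hN γ t) := by
      rw [hcy]
      refine (hcoeff x _).symm.trans ?_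
      rw [Equiv.symm_apply_apply]
    have e2 : c ((galoisEquiv σ hT').symm (galoisEquiv σ hT t)) = (φ x).coeff t := by
      rw [hcy]
      refine (hcoeff x _).symm.trans ?_
      rw [Equiv.symm_apply_apply]
    rw [e1]
    refine hx.trans ?_
    rw [← e2]
    exact (hc γ _).symm
  intro t ht
  set t' := (galoisEquiv σ hT').symm (galoisEquiv σ hT ⟨t, ht⟩) with ht'
  have : (t : AffGroup p n)⁻¹ = (t' : AffGroup p n)⁻¹ := by
    ext x : 1
    have := (galoisEquiv_galoisConj σ hT hN (-x) ⟨t, ht⟩).symm.trans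
      ((hequiv ⟨t, ht⟩ (σ (.ofAdd (-x)))).trans (galoisEquiv_galoisConj σ hT' hN' (-x) t'))
    rw [EmbeddingLike.apply_eq_iff_eq,
      EmbeddingLike.apply_eq_iff_eq, neg_neg] at this
    exact add_left_cancel this
  rw [inv_inj] at this
  rw [this]
  exact t'.2

variable [IsGalois K L]

theorem exists_arisesFrom (hT : IsRegularSubgroup T) (hN : IsNormalizedByTranslations T) :
    ∃ S : HopfGaloisStructure K L, S.ArisesFrom σ T := by
  classical
  have := finite_of_isRegularSubgroup hT
  let _ := Fintype.ofFinite T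
  let ρ := galoisConj σ hN
  refine ⟨descentStructure ρ (galoisEquiv σ hT) (galoisEquiv_one σ hT)
    (galoisEquiv_mul σ hT hN), hN, (fixedSubalgebra ρ).val, Subtype.val_injective, ?_, ?_, ?_, ?_⟩
  · intro b
    rw [forall_conj_iff σ hN]
    constructor
    · rintro ⟨h, rfl⟩
      exact h.2
    · intro hb
      exact ⟨⟨b, hb⟩, rfl⟩
  · intro (b : fixedSubalgebra ρ)
    change Coalgebra.counit (R := L) (b : MonoidAlgebra L T) = algebraMap K L (fixedCounit ρ b)
    rw [algebraMap_fixedCounit]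
    conv_lhs => rw [← MonoidAlgebra.sum_single_coeff b.1, map_sum]
    simp [fixedCoeff_apply]
  · intro b
    apply coeffFunctional₂_ext
    intro s t
    rw [coeffFunctional₂_comul]
    refine Eq.trans ?_ (coeffFunctional₂_mapOfCompatibleSMul _ (fixedCoeff ρ)
      (fun _ _ => rfl) _ s t).symm
    exact (fixedCoeff₂_comul ρ b s t).symm
  · intro b a
    refine (twistedAction_apply ρ (galoisEquiv σ hT) b a).trans ?_
    rw [Finsupp.sum_fintype _ _ (by simp)]
    rfl

/-- Both Hopf algebras embed onto the same fixed ring, which gives the algebra isomorphism. It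
respects comultiplication because tensors embed in functions on T × T, where both comultiplications
are the same diagonal function. -/
theorem iso_of_arisesFrom (hT : IsRegularSubgroup T) {S S' : HopfGaloisStructure K L}
    (h : S.ArisesFrom σ T) (h' : S'.ArisesFrom σ T) : S.Iso S' := by
  classical
  have := finite_of_isRegularSubgroup hT
  let _ := Fintype.ofFinite T
  obtain ⟨hN, φ, hinj, hrange, hcounit, hcomul, hact⟩ := h
  obtain ⟨-, φ', hinj', hrange', hcounit', hcomul', hact'⟩ := h'
  have hran : φ.range = φ'.range := by
    ext b
    exact (hrange b).trans (hrange' b).symm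
  let f : S.H ≃ₐ[K] S'.H := (AlgEquiv.ofInjective φ hinj).trans
    ((Subalgebra.equivOfEq _ _ hran).trans (AlgEquiv.ofInjective φ' hinj').symm)
  have hf : ∀ x, φ' (f x) = φ x := by
    intro x
    have := (AlgEquiv.ofInjective φ' hinj').apply_symm_apply
      (Subalgebra.equivOfEq _ _ hran (AlgEquiv.ofInjective φ hinj x))
    exact congrArg Subtype.val this
  have hdelta : ∀ x s t, tensorToFun (coeffMap φ) (coeffMap φ) (Coalgebra.comul (R := K) x) (s, t) =
      if s = t then (φ x).coeff s else 0 := by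
    intro x s t
    rw [← coeffFunctional₂_mapOfCompatibleSMul φ.toLinearMap (coeffMap φ) (fun _ _ => rfl),
      ← hcomul, coeffFunctional₂_comul]
  have hdelta' : ∀ x s t,
      tensorToFun (coeffMap φ') (coeffMap φ') (Coalgebra.comul (R := K) x) (s, t) =
      if s = t then (φ' x).coeff s else 0 := by
    intro x s t
    rw [← coeffFunctional₂_mapOfCompatibleSMul φ'.toLinearMap (coeffMap φ') (fun _ _ => rfl),
      ← hcomul', coeffFunctional₂_comul]
  have hmem' : ∀ x, coeffMap φ' x ∈ equivariantFunctions (permAction (galoisConj σ hN)) :=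
    fun x => (forall_conj_iff σ hN _).1 ((hrange' _).1 ⟨x, rfl⟩)
  refine ⟨BialgEquiv.ofAlgEquiv f ?_ ?_, ?_⟩
  · ext x
    apply FaithfulSMul.algebraMap_injective K L
    change algebraMap K L (Coalgebra.counit (f x)) = algebraMap K L (Coalgebra.counit x)
    rw [← hcounit, ← hcounit', hf]
  · ext x
    apply tensorToFun_injective _ (coeffMap_injective hinj') hmem' (coeffMap_injective hinj')
    have hmap : ∀ z : S.H ⊗[K] S.H, tensorToFun (coeffMap φ') (coeffMap φ')
        (Algebra.TensorProduct.map f.toAlgHom f.toAlgHom z) =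
          tensorToFun (coeffMap φ) (coeffMap φ) z := by
      intro z
      induction z with
      | zero => simp
      | add z w hz hw => simp only [map_add, hz, hw]
      | tmul a b =>
        ext ⟨s, t⟩
        simp [coeffMap, hf]
    ext ⟨s, t⟩
    change tensorToFun (coeffMap φ') (coeffMap φ') (Algebra.TensorProduct.map f.toAlgHom f.toAlgHom
      (Coalgebra.comul (R := K) x)) (s, t) = tensorToFun (coeffMap φ') (coeffMap φ')
      (Coalgebra.comul (R := K) (f x)) (s, t)
    rw [hmap, hdelta, hdelta', hf]
  · intro x
    ext a
    change S'.act (f x) a = S.act x a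
    rw [hact, hact', hf]

end HopfGaloisStructure

end Correspondence

/-! ### Associated regular subgroups are normalized by the translations -/

section Associated

variable {p n : ℕ} {A : Type*} [NonUnitalCommRing A] [Module (ZMod p) A]

/-- Conjugating τ(x) by the translation by g gives y ↦ g + x + (y - g) + x(y - g), which is τ(x -
xg) because (xg)y = 0. -/
theorem IsAssociated.isNormalizedByTranslations {T : Subgroup (AffGroup p n)}
    (hcube : ∀ x y z : A, x * y * z = 0) (hT : IsAssociated A T) :
    IsNormalizedByTranslations T := by
  obtain ⟨μ, ⟨e, he⟩, hrange⟩ := hT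
  have hzero : ∀ x y z, μ (μ x y) z = 0 := by
    intro x y z
    have := he (e.symm x * e.symm y) (e.symm z)
    rw [hcube, map_zero, he] at this
    simpa using this.symm
  have hsymm : ∀ x y, μ x y = μ y x := by
    intro x y
    have h1 := he (e.symm x) (e.symm y)
    have h2 := he (e.symm y) (e.symm x)
    rw [mul_comm, h2] at h1
    simpa using h1.symm
  intro g t ht
  obtain ⟨x, hx⟩ : (t : FpVec p n → FpVec p n) ∈ Set.range (circleProductMap μ) :=
    hrange ▸ ⟨t, ht, rfl⟩
  obtain ⟨t', ht', hx'⟩ : circleProductMap μ (x - μ x g) ∈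
      (fun t : AffGroup p n => (t : FpVec p n → FpVec p n)) '' (T : Set (AffGroup p n)) :=
    hrange ▸ ⟨_, rfl⟩
  have : translation p n g * t * (translation p n g)⁻¹ = t' := by
    ext y : 1
    have h1 : t' y = _ := congrFun hx' y
    rw [translation_conj_apply, h1, ← hx]
    simp only [circleProductMap, map_add, map_neg, map_sub, LinearMap.sub_apply, hzero, sub_zero]
    abel
  rw [this]
  exact ht'

variable [NeZero p] {K : Type u} {L : Type v} [Field K] [Field L] [Algebra K L]
  [FiniteDimensional K L] [IsGalois K L]

open HopfGaloisStructure in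
theorem ncard_associatedHopfGaloisStructures (hcube : ∀ x y z : A, x * y * z = 0)
    (σ : Multiplicative (FpVec p n) ≃* (L ≃ₐ[K] L)) :
    (associatedHopfGaloisStructures K L σ A).ncard = (associatedRegularSubgroups p n A).ncard := by
  choose F hF using fun (T : Subgroup (AffGroup p n)) (hT : T ∈ associatedRegularSubgroups p n A) =>
    exists_arisesFrom σ hT.1 (hT.2.isNormalizedByTranslations hcube)
  symm
  refine Set.ncard_congr (fun T hT => Quotient.mk _ (F T hT)) ?_ ?_ ?_
  · intro T hT
    exact ⟨_, rfl, T, hT, hF T hT⟩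
  · intro T T' hT hT' h
    have hiso : (F T hT).Iso (F T' hT') := Quotient.exact h
    exact le_antisymm (le_of_iso σ hT.1 hT'.1 (hF _ _) (hF _ _) hiso)
      (le_of_iso σ hT'.1 hT.1 (hF _ _) (hF _ _) hiso.symm)
  · rintro _ ⟨S, rfl, T, hT, hS⟩
    exact ⟨T, hT, Quotient.sound (iso_of_arisesFrom σ hT.1 (hF T hT) hS)⟩

end Associated

/-! ### Congruence of Gram matrices -/

namespace Matrix

variable {F : Type*} [Field F] {ι κ τ ι' κ' : Type*} [Fintype ι] [Fintype κ] [Fintype τ]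
  [DecidableEq ι] [DecidableEq κ] [DecidableEq τ] [Fintype ι'] [Fintype κ'] [DecidableEq ι']
  [DecidableEq κ']

/-- Congruence of Gram matrices, possibly with different index types. -/
def IsCongruent (S : Matrix ι ι F) (S' : Matrix κ κ F) : Prop :=
  ∃ (U : Matrix ι κ F) (V : Matrix κ ι F), U * V = 1 ∧ V * U = 1 ∧ U.transpose * S * U = S'

theorem IsCongruent.refl (S : Matrix ι ι F) : IsCongruent S S := ⟨1, 1, by simp⟩

theorem IsCongruent.symm {S : Matrix ι ι F} {S' : Matrix κ κ F} (h : IsCongruent S S') :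
    IsCongruent S' S := by
  obtain ⟨U, V, h1, h2, rfl⟩ := h
  refine ⟨V, U, h2, h1, ?_⟩
  have h3 : V.transpose * U.transpose = 1 := by rw [← transpose_mul, h1, transpose_one]
  calc V.transpose * (U.transpose * S * U) * V
      = (V.transpose * U.transpose) * S * (U * V) := by simp only [Matrix.mul_assoc]
    _ = S := by rw [h1, h3, Matrix.one_mul, Matrix.mul_one]

theorem IsCongruent.trans {S : Matrix ι ι F} {S' : Matrix κ κ F} {S'' : Matrix τ τ F}
    (h : IsCongruent S S') (h' : IsCongruent S' S'') : IsCongruent S S'' := by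
  obtain ⟨U, V, h1, h2, rfl⟩ := h
  obtain ⟨U', V', h1', h2', rfl⟩ := h'
  refine ⟨U * U', V' * V, ?_, ?_, ?_⟩
  · calc U * U' * (V' * V) = U * (U' * V') * V := by simp only [Matrix.mul_assoc]
      _ = 1 := by rw [h1', Matrix.mul_one, h1]
  · calc V' * V * (U * U') = V' * (V * U) * U' := by simp only [Matrix.mul_assoc]
      _ = 1 := by rw [h2, Matrix.mul_one, h2']
  · simp only [transpose_mul, Matrix.mul_assoc]

theorem IsCongruent.reindex (S : Matrix ι ι F) (e : κ ≃ ι) : IsCongruent S (S.submatrix e e) := by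
  refine ⟨(1 : Matrix ι ι F).submatrix id e, (1 : Matrix ι ι F).submatrix e id, ?_, ?_, ?_⟩
  · simp [submatrix_mul_equiv]
  · rw [← submatrix_mul _ _ _ _ _ Function.bijective_id]
    simp
  · rw [transpose_submatrix, transpose_one]
    ext i j
    simp [Matrix.mul_apply, Matrix.one_apply]

theorem IsCongruent.fromBlocks {S : Matrix ι ι F} {S' : Matrix κ κ F} {R : Matrix ι' ι' F}
    {R' : Matrix κ' κ' F} (h : IsCongruent S S') (h' : IsCongruent R R') :
    IsCongruent (fromBlocks S 0 0 R) (fromBlocks S' 0 0 R') := by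
  obtain ⟨U, V, h1, h2, rfl⟩ := h
  obtain ⟨U', V', h1', h2', rfl⟩ := h'
  refine ⟨Matrix.fromBlocks U 0 0 U', Matrix.fromBlocks V 0 0 V', ?_, ?_, ?_⟩ <;>
    simp [fromBlocks_multiply, fromBlocks_transpose, *]

theorem IsCongruent.diagonal_scale (w c : ι → F) (hc : ∀ i, c i ≠ 0) :
    IsCongruent (diagonal w) (diagonal fun i => c i ^ 2 * w i) := by
  refine ⟨diagonal c, diagonal c⁻¹, ?_, ?_, ?_⟩
  · rw [diagonal_mul_diagonal, ← diagonal_one]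
    congr 1
    ext i
    simp [hc i]
  · rw [diagonal_mul_diagonal, ← diagonal_one]
    congr 1
    ext i
    simp [hc i]
  · rw [diagonal_transpose, diagonal_mul_diagonal, diagonal_mul_diagonal]
    congr 1
    ext i
    ring

theorem isCongruent_diagonal_reindex (w : ι → F) (e : κ ≃ ι) :
    IsCongruent (diagonal w) (diagonal (w ∘ e)) := by
  have := IsCongruent.reindex (diagonal w) e
  rwa [submatrix_diagonal_equiv] at this

/-- A binary form over a finite field represents 1: by counting, the values of a·x² and of 1 - b·y²
must overlap. -/
theorem exists_mul_sq_add_mul_sq_eq_one [Fintype F] (hF : ringChar F ≠ 2) {a b : F} (ha : a ≠ 0)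
    (hb : b ≠ 0) : ∃ x y, a * x ^ 2 + b * y ^ 2 = 1 := by
  open Polynomial in
  obtain ⟨x, y, h⟩ := FiniteField.exists_root_sum_quadratic (R := F)
    (f := C a * X ^ 2) (g := C b * X ^ 2 + C 0 * X + C (-1)) (degree_C_mul_X_pow 2 ha)
    (degree_quadratic hb) (FiniteField.odd_card_of_char_ne_two hF)
  refine ⟨x, y, ?_⟩
  simp at h
  linear_combination h

theorem isCongruent_diagonal_pair [Fintype F] (hF : ringChar F ≠ 2) {a b : F} (ha : a ≠ 0)
    (hb : b ≠ 0) : IsCongruent (diagonal (Sum.elim (fun _ : Unit => a) (fun _ : Unit => b)))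
      (diagonal (Sum.elim (fun _ : Unit => 1) (fun _ : Unit => a * b))) := by
  obtain ⟨x, y, h⟩ := exists_mul_sq_add_mul_sq_eq_one hF ha hb
  -- The new basis is a vector (x, y) of norm 1 and its orthogonal vector (-by, ax), of norm ab(ax²
  -- + by²) = ab. The determinant is ax² + by² = 1, so the inverse is the adjugate.
  refine ⟨Matrix.fromBlocks (of fun _ _ => x) (of fun _ _ => -(b * y)) (of fun _ _ => y)
    (of fun _ _ => a * x), Matrix.fromBlocks (of fun _ _ => a * x) (of fun _ _ => b * y)
    (of fun _ _ => -y) (of fun _ _ => x), ?_, ?_, ?_⟩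
  · ext (i | i) (j | j) <;> simp [Matrix.mul_apply, fromBlocks] <;> grind
  · ext (i | i) (j | j) <;> simp [Matrix.mul_apply, fromBlocks] <;> grind
  · ext (i | i) (j | j) <;>
      simp [Matrix.mul_apply, diagonal_apply, fromBlocks] <;> grind

/-- Induction on the rank: normalize all entries but the last, so that their product P stands next
to the last entry w, then replace the pair (P, w) by (1, Pw). The remaining steps only reindex. -/
theorem isCongruent_diagonal_normal_form [Fintype F] (hF : ringChar F ≠ 2) (k : ℕ)
    (w : Fin k ⊕ Unit → F) (hw : ∀ i, w i ≠ 0) :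
    IsCongruent (diagonal w)
      (diagonal (Sum.elim (fun _ : Fin k => 1) (fun _ : Unit => ∏ i, w i))) := by
  induction k with
  | zero =>
    have : Sum.elim (fun _ : Fin 0 => 1) (fun _ : Unit => ∏ i, w i) = w := by
      ext (x | x)
      · exact x.elim0
      · simp
    rw [this]
    exact IsCongruent.refl _
  | succ k ih =>
    let e : (Fin k ⊕ Unit) ⊕ Unit ≃ Fin (k + 1) ⊕ Unit :=
      (finSumFinEquiv (m := k) (n := 1)).symm.trans ((Equiv.refl _).sumCongr
        (Equiv.ofUnique (Fin 1) Unit)) |>.symm.sumCongr (Equiv.refl _)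
    have h1 := isCongruent_diagonal_reindex w e
    have h2 : w ∘ e = Sum.elim (w ∘ e ∘ Sum.inl) (w ∘ e ∘ Sum.inr) :=
      (Sum.elim_comp_inl_inr (w ∘ e)).symm
    have h3 := (ih (w ∘ e ∘ Sum.inl) (fun i => hw _)).fromBlocks
      (IsCongruent.refl (diagonal (w ∘ e ∘ Sum.inr)))
    rw [fromBlocks_diagonal, fromBlocks_diagonal, ← h2] at h3
    have h4 := isCongruent_diagonal_pair hF (a := ∏ i, (w ∘ e ∘ Sum.inl) i)
      (b := (w ∘ e ∘ Sum.inr) ()) (Finset.prod_ne_zero_iff.2 fun i _ => hw _) (hw _)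
    have h5 := (IsCongruent.refl (diagonal fun _ : Fin k => (1 : F))).fromBlocks h4
    rw [fromBlocks_diagonal, fromBlocks_diagonal] at h5
    have h6 := isCongruent_diagonal_reindex (Sum.elim (fun _ : Fin k => (1 : F))
      (Sum.elim (fun _ : Unit => ∏ i, (w ∘ e ∘ Sum.inl) i)
        (fun _ : Unit => (w ∘ e ∘ Sum.inr) ()))) (Equiv.sumAssoc (Fin k) Unit Unit)
    have h7 := isCongruent_diagonal_reindex (Sum.elim (fun _ : Fin k => (1 : F))
      (Sum.elim (fun _ : Unit => (1 : F)) (fun _ : Unit => (∏ i, (w ∘ e ∘ Sum.inl) i) *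
        (w ∘ e ∘ Sum.inr) ()))) ((Equiv.sumAssoc (Fin k) Unit Unit).symm.trans e).symm
    have h8 : Sum.elim (Sum.elim (fun _ : Fin k => (1 : F))
        (fun _ : Unit => ∏ i, (w ∘ e ∘ Sum.inl) i)) (w ∘ e ∘ Sum.inr) =
        Sum.elim (fun _ : Fin k => (1 : F)) (Sum.elim (fun _ : Unit => ∏ i, (w ∘ e ∘ Sum.inl) i)
          (fun _ : Unit => (w ∘ e ∘ Sum.inr) ())) ∘ Equiv.sumAssoc (Fin k) Unit Unit := by
      ext ((x | x) | x) <;> rfl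
    have h9 : Sum.elim (fun _ : Fin (k + 1) => (1 : F)) (fun _ : Unit => ∏ i, w i) =
        Sum.elim (fun _ : Fin k => (1 : F)) (Sum.elim (fun _ : Unit => (1 : F))
          (fun _ : Unit => (∏ i, (w ∘ e ∘ Sum.inl) i) * (w ∘ e ∘ Sum.inr) ())) ∘
            ((Equiv.sumAssoc (Fin k) Unit Unit).symm.trans e).symm := by
      ext x
      obtain ⟨y, rfl⟩ := e.surjective x
      rw [← Equiv.prod_comp e, Fintype.prod_sum_type]
      simp only [Function.comp_apply, Equiv.symm_trans_apply, Equiv.symm_apply_apply]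
      rcases y with ((y | y) | y) <;> simp [e]
    rw [← h8] at h6
    rw [h9]
    exact (h1.trans h3).trans ((h6.symm.trans h5).trans h7)

/-- Nondegenerate diagonal forms of the same rank whose determinants differ by a square are
congruent over a finite field of odd characteristic. -/
theorem isCongruent_diagonal_of_isSquare [Fintype F] (hF : ringChar F ≠ 2) [Nonempty ι]
    (hcard : Fintype.card ι = Fintype.card κ) {w : ι → F} {w' : κ → F} (hw : ∀ i, w i ≠ 0)
    (hw' : ∀ i, w' i ≠ 0) (h : IsSquare ((∏ i, w i) * ∏ i, w' i)) :
    IsCongruent (diagonal w) (diagonal w') := by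
  obtain ⟨k, hk⟩ := Nat.exists_eq_succ_of_ne_zero (Fintype.card_ne_zero (α := ι))
  have hs : Fintype.card (Fin k ⊕ Unit) = Fintype.card ι := by simp [hk]
  let e := Fintype.equivOfCardEq hs
  let e' := Fintype.equivOfCardEq (hs.trans hcard)
  have h1 := (isCongruent_diagonal_reindex w e).trans
    (isCongruent_diagonal_normal_form hF k (w ∘ e) fun i => hw _)
  have h2 := (isCongruent_diagonal_reindex w' e').trans
    (isCongruent_diagonal_normal_form hF k (w' ∘ e') fun i => hw' _)
  simp only [Function.comp_apply, Equiv.prod_comp e, Equiv.prod_comp e'] at h1 h2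
  have hP : ∏ i, w i ≠ 0 := Finset.prod_ne_zero_iff.2 fun i _ => hw i
  have hP' : ∏ i, w' i ≠ 0 := Finset.prod_ne_zero_iff.2 fun i _ => hw' i
  obtain ⟨d, hd⟩ := h
  have hd0 : d ≠ 0 := by
    rintro rfl
    simp [hP, hP'] at hd
  -- With P, P' the two products and P·P' = d², scaling the last vector by d/P changes its norm from
  -- P to d²/P = P'.
  have h3 := IsCongruent.diagonal_scale (Sum.elim (fun _ : Fin k => (1 : F))
    (fun _ : Unit => ∏ i, w i)) (Sum.elim (fun _ : Fin k => (1 : F))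
    (fun _ : Unit => d / ∏ i, w i)) (by rintro (i | i) <;> simp [hd0, hP])
  have h4 : (fun i => (Sum.elim (fun _ : Fin k => (1 : F)) (fun _ : Unit => d / ∏ i, w i)) i ^ 2 *
      (Sum.elim (fun _ : Fin k => (1 : F)) (fun _ : Unit => ∏ i, w i)) i) =
      Sum.elim (fun _ : Fin k => (1 : F)) (fun _ : Unit => ∏ i, w' i) := by
    ext (i | i)
    · simp
    · simp only [Sum.elim_inr]
      field_simp
      linear_combination -hd
  rw [h4] at h3
  exact (h1.trans h3).trans h2.symm

end Matrix

/-! ### Orders of isometry groups and numbers of similitudes -/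

section Isometry

open Matrix

variable {p : ℕ} {ι κ : Type} [Fintype ι] [Fintype κ] [DecidableEq ι] [DecidableEq κ]

theorem mem_isometryGroup {S : Matrix ι ι (ZMod p)} {g : GL ι (ZMod p)} :
    g ∈ isometryGroup S ↔ (g : Matrix ι ι (ZMod p)).transpose * S * g = S := Iff.rfl

variable [Fact p.Prime]

/-- For a nondegenerate form the isometries are the matrices preserving the form. -/
def isometryEquiv (S : Matrix ι ι (ZMod p)) (hS : S.det ≠ 0) :
    isometryGroup S ≃ {U : Matrix ι ι (ZMod p) // U.transpose * S * U = S} where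
  toFun g := ⟨(g : GL ι (ZMod p)), g.2⟩
  invFun U := ⟨GeneralLinearGroup.mkOfDetNeZero U.1 (by
    intro h
    apply hS
    rw [← U.2, det_mul, h, mul_zero]), U.2⟩
  left_inv g := by
    ext
    rfl
  right_inv U := rfl

/-- A congruence `UᵀSU = S'` turns the solutions of `XᵀSX = S` into those of `XᵀSX = S'`. -/
theorem card_transpose_mul_mul_eq {S : Matrix ι ι (ZMod p)} {S' : Matrix κ κ (ZMod p)}
    (hS : S.det ≠ 0) (h : IsCongruent S S') :
    Nat.card {X : Matrix ι κ (ZMod p) // X.transpose * S * X = S'} =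
      Nat.card (isometryGroup S) := by
  obtain ⟨U, V, h1, h2, h3⟩ := h
  have h4 : V.transpose * U.transpose = 1 := by rw [← transpose_mul, h1, transpose_one]
  rw [Nat.card_congr (isometryEquiv S hS)]
  refine Nat.card_congr ⟨fun X => ⟨X.1 * V, ?_⟩, fun X => ⟨X.1 * U, ?_⟩, fun X => ?_, fun X => ?_⟩
  · calc (X.1 * V).transpose * S * (X.1 * V)
        = V.transpose * (X.1.transpose * S * X.1) * V := by
          simp only [transpose_mul, Matrix.mul_assoc]
      _ = (V.transpose * U.transpose) * S * (U * V) := by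
          rw [X.2, ← h3]
          simp only [Matrix.mul_assoc]
      _ = S := by rw [h1, h4, Matrix.one_mul, Matrix.mul_one]
  · calc (X.1 * U).transpose * S * (X.1 * U)
        = U.transpose * (X.1.transpose * S * X.1) * U := by
          simp only [transpose_mul, Matrix.mul_assoc]
      _ = S' := by rw [X.2, h3]
  · exact Subtype.ext (by simp only [Matrix.mul_assoc, h2, Matrix.mul_one])
  · exact Subtype.ext (by simp only [Matrix.mul_assoc, h1, Matrix.mul_one])

/-- Conjugation by the base change carries one isometry group onto the other; nondegeneracy plays no
role. -/
theorem card_isometryGroup_eq {S : Matrix ι ι (ZMod p)} {S' : Matrix κ κ (ZMod p)}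
    (h : IsCongruent S S') : Nat.card (isometryGroup S) = Nat.card (isometryGroup S') := by
  obtain ⟨U, V, h1, h2, h3⟩ := h
  have hconj : ∀ {α β : Type} [Fintype α] [Fintype β] [DecidableEq α] [DecidableEq β]
      (P : Matrix α β (ZMod p)) (Q : Matrix β α (ZMod p)), P * Q = 1 → Q * P = 1 →
      ∀ g : GL α (ZMod p), (Q * g.1 * P) * (Q * g.2 * P) = 1 := by
    intro α β _ _ _ _ P Q hPQ hQP g
    calc (Q * g.1 * P) * (Q * g.2 * P) = Q * (g.1 * (P * Q) * g.2) * P := by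
          simp only [Matrix.mul_assoc]
      _ = 1 := by rw [hPQ, Matrix.mul_one, g.3, Matrix.mul_one, hQP]
  let e : GL ι (ZMod p) ≃ GL κ (ZMod p) :=
    { toFun := fun g => ⟨V * g.1 * U, V * g.2 * U, hconj U V h1 h2 g, hconj U V h1 h2 g⁻¹⟩
      invFun := fun g => ⟨U * g.1 * V, U * g.2 * V, hconj V U h2 h1 g, hconj V U h2 h1 g⁻¹⟩
      left_inv := fun g => Units.ext (by
        change U * (V * g.1 * U) * V = g.1
        calc U * (V * g.1 * U) * V = (U * V) * g.1 * (U * V) := by simp only [Matrix.mul_assoc]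
          _ = g.1 := by rw [h1, Matrix.one_mul, Matrix.mul_one])
      right_inv := fun g => Units.ext (by
        change V * (U * g.1 * V) * U = g.1
        calc V * (U * g.1 * V) * U = (V * U) * g.1 * (V * U) := by simp only [Matrix.mul_assoc]
          _ = g.1 := by rw [h2, Matrix.one_mul, Matrix.mul_one]) }
  have h4 : V.transpose * U.transpose = 1 := by rw [← transpose_mul, h1, transpose_one]
  refine Nat.card_congr (e.subtypeEquiv fun g => ?_)
  rw [mem_isometryGroup, mem_isometryGroup]
  change _ ↔ (V * g.1 * U).transpose * S' * (V * g.1 * U) = S'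
  have h5 : (V * g.1 * U).transpose * S' * (V * g.1 * U) =
      U.transpose * (g.1.transpose * S * g.1) * U := by
    calc (V * g.1 * U).transpose * S' * (V * g.1 * U)
        = U.transpose * g.1.transpose * (V.transpose * U.transpose) * S * (U * V) * g.1 * U := by
          rw [← h3]
          simp only [transpose_mul, Matrix.mul_assoc]
      _ = _ := by
          rw [h4, h1]
          simp only [Matrix.mul_assoc, Matrix.one_mul]
  rw [h5]
  constructor
  · intro h
    rw [h, h3]
  · intro h
    have : V.transpose * (U.transpose * (g.1.transpose * S * g.1) * U) * V =
        V.transpose * (U.transpose * S * U) * V := by rw [h, h3]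
    have h6 : ∀ M : Matrix ι ι (ZMod p), V.transpose * (U.transpose * M * U) * V = M := by
      intro M
      calc V.transpose * (U.transpose * M * U) * V
          = (V.transpose * U.transpose) * M * (U * V) := by simp only [Matrix.mul_assoc]
        _ = M := by rw [h1, h4, Matrix.one_mul, Matrix.mul_one]
    rwa [h6, h6] at this

/-- The similitudes of a form, with their multipliers. -/
abbrev Similitudes (S : Matrix ι ι (ZMod p)) : Type :=
  Σ c : (ZMod p)ˣ, {X : Matrix ι ι (ZMod p) // X.transpose * S * X = (c : ZMod p) • S}

/-- Fibre over the multiplier: a fibre is empty unless Q holds, and otherwise has the size of the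
isometry group by `card_transpose_mul_mul_eq`. -/
theorem card_similitudes (S : Matrix ι ι (ZMod p)) (hS : S.det ≠ 0) (Q : (ZMod p)ˣ → Prop)
    (hQ : ∀ c, Q c → IsCongruent S ((c : ZMod p) • S))
    (hQ' : ∀ (c : (ZMod p)ˣ) (X : Matrix ι ι (ZMod p)),
      X.transpose * S * X = (c : ZMod p) • S → Q c) :
    Nat.card (Similitudes S) = Nat.card {c // Q c} * Nat.card (isometryGroup S) := by
  classical
  rw [Nat.card_sigma]
  have : ∀ c : (ZMod p)ˣ,
      Nat.card {X : Matrix ι ι (ZMod p) // X.transpose * S * X = (c : ZMod p) • S} =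
        if Q c then Nat.card (isometryGroup S) else 0 := by
    intro c
    split_ifs with h
    · exact card_transpose_mul_mul_eq hS (hQ c h)
    · have : IsEmpty {X : Matrix ι ι (ZMod p) // X.transpose * S * X = (c : ZMod p) • S} :=
        ⟨fun X => h (hQ' c X.1 X.2)⟩
      exact Nat.card_of_isEmpty
  simp_rw [this]
  rw [Finset.sum_ite, Finset.sum_const, Finset.sum_const_zero, add_zero, smul_eq_mul,
    Nat.card_eq_fintype_card (α := {c // Q c}), Fintype.card_subtype]

theorem card_isSquare_units (hp : p ≠ 2) :
    2 * Nat.card {c : (ZMod p)ˣ // IsSquare c} = p - 1 := by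
  let f : (ZMod p)ˣ →* (ZMod p)ˣ := powMonoidHom 2
  have hker : Nat.card f.ker = 2 := by
    have : (f.ker : Set (ZMod p)ˣ) = {1, -1} := by
      ext x
      simp only [SetLike.mem_coe, MonoidHom.mem_ker, f, powMonoidHom_apply, Set.mem_insert_iff,
        Set.mem_singleton_iff, Units.ext_iff, Units.val_pow_eq_pow_val, Units.val_one,
        Units.val_neg, sq_eq_one_iff]
    rw [← SetLike.coe_sort_coe, Nat.card_coe_set_eq, this, Set.ncard_pair]
    intro h
    have h1 : (1 : ZMod p) = -1 := congrArg Units.val h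
    have : Fact (2 < p) := ⟨lt_of_le_of_ne (Fact.out : p.Prime).two_le (Ne.symm hp)⟩
    exact ZMod.neg_one_ne_one (n := p) h1.symm
  have hrange : Nat.card f.range = Nat.card {c : (ZMod p)ˣ // IsSquare c} :=
    Nat.card_congr (Equiv.subtypeEquivRight fun c => by
      simp [f, isSquare_iff_exists_sq, eq_comm])
  have := f.ker.card_mul_index
  rw [Subgroup.index_ker, hker, hrange, Nat.card_eq_fintype_card (α := (ZMod p)ˣ),
    ZMod.card_units] at this
  exact this

end Isometry

/-! ### Regular subgroups and algebra structures -/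

section AlgebraStructures

variable {p n : ℕ}

/-- The algebra structures on `𝔽_p ^ n` isomorphic to `A`. -/
def transportedStructures (p n : ℕ) (A : Type*) [NonUnitalCommRing A] [Module (ZMod p) A] :
    Set (FpVec p n →ₗ[ZMod p] FpVec p n →ₗ[ZMod p] FpVec p n) :=
  {μ | ∃ e : A ≃ₗ[ZMod p] FpVec p n, ∀ x y : A, e (x * y) = μ (e x) (e y)}

/-- The affine group `{y ↦ x + y + μ x y}` of a commutative nilpotent algebra structure `μ` of
class at most `2`. -/
def circleSubgroup (μ : FpVec p n →ₗ[ZMod p] FpVec p n →ₗ[ZMod p] FpVec p n)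
    (hsymm : ∀ x y, μ x y = μ y x) (hzero : ∀ x y z, μ (μ x y) z = 0) :
    Subgroup (AffGroup p n) where
  carrier := {t | ∃ x, (t : FpVec p n → FpVec p n) = circleProductMap μ x}
  one_mem' := ⟨0, by
    ext y : 1
    simp [circleProductMap]⟩
  mul_mem' := by
    rintro s t ⟨x, hx⟩ ⟨y, hy⟩
    refine ⟨x + y + μ x y, ?_⟩
    ext z : 1
    change s (t z) = _
    rw [hx, hy]
    simp only [circleProductMap, map_add, LinearMap.add_apply, hzero, hsymm x (μ y z)]
    abel
  inv_mem' := by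
    rintro t ⟨x, hx⟩
    -- The geometric series for the circle inverse stops here, because triple products vanish.
    refine ⟨-x + μ x x, ?_⟩
    ext z : 1
    rw [inv_apply_eq_iff, hx]
    simp only [circleProductMap, map_add, map_neg, LinearMap.add_apply, LinearMap.neg_apply, hzero,
      hsymm x (μ _ _), hsymm x 0, map_zero, LinearMap.zero_apply]
    abel

theorem mem_circleSubgroup {μ : FpVec p n →ₗ[ZMod p] FpVec p n →ₗ[ZMod p] FpVec p n}
    {hsymm : ∀ x y, μ x y = μ y x} {hzero : ∀ x y z, μ (μ x y) z = 0} {t : AffGroup p n} :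
    t ∈ circleSubgroup μ hsymm hzero ↔
      ∃ x, (t : FpVec p n → FpVec p n) = circleProductMap μ x := Iff.rfl

/-- The affine map `y ↦ x + y + μ x y`. -/
def circleAffineEquiv (μ : FpVec p n →ₗ[ZMod p] FpVec p n →ₗ[ZMod p] FpVec p n)
    (hsymm : ∀ x y, μ x y = μ y x) (hzero : ∀ x y z, μ (μ x y) z = 0) (x : FpVec p n) :
    AffGroup p n :=
  (LinearEquiv.ofLinearMap (LinearMap.id + μ x) (LinearMap.id - μ x)
    (LinearMap.ext fun y => by simp [hsymm x (μ x _), hzero])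
    (LinearMap.ext fun y => by simp [hsymm x (μ x _), hzero])).toAffineEquiv.trans
    (AffineEquiv.constVAdd (ZMod p) (FpVec p n) x)

theorem coe_circleAffineEquiv (μ : FpVec p n →ₗ[ZMod p] FpVec p n →ₗ[ZMod p] FpVec p n)
    (hsymm : ∀ x y, μ x y = μ y x) (hzero : ∀ x y z, μ (μ x y) z = 0) (x : FpVec p n) :
    (circleAffineEquiv μ hsymm hzero x : FpVec p n → FpVec p n) = circleProductMap μ x := by
  ext1 y
  exact (add_assoc x y (μ x y)).symm

/-- By commutativity τ(a)(x) = τ(x)(a), so solving τ(a)(x) = y for a amounts to inverting the affine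
bijection τ(x). -/
theorem isRegularSubgroup_circleSubgroup
    (μ : FpVec p n →ₗ[ZMod p] FpVec p n →ₗ[ZMod p] FpVec p n)
    (hsymm : ∀ x y, μ x y = μ y x) (hzero : ∀ x y z, μ (μ x y) z = 0) :
    IsRegularSubgroup (circleSubgroup μ hsymm hzero) := by
  intro x y
  have hcirc : ∀ a, circleProductMap μ a x = x + circleProductMap μ x a - x := by
    intro a
    simp only [circleProductMap, hsymm a x]
    abel
  let E := circleAffineEquiv μ hsymm hzero x
  have hE : ∀ a, circleProductMap μ a x = E a := by
    intro a
    rw [hcirc, coe_circleAffineEquiv]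
    abel
  refine ⟨circleAffineEquiv μ hsymm hzero (E.symm y),
    ⟨⟨_, coe_circleAffineEquiv μ hsymm hzero _⟩, ?_⟩, ?_⟩
  · rw [coe_circleAffineEquiv, hE, AffineEquiv.apply_symm_apply]
  · rintro t ⟨⟨a, ha⟩, hty⟩
    rw [ha, hE] at hty
    apply DFunLike.coe_injective
    rw [ha, coe_circleAffineEquiv, ← hty, AffineEquiv.symm_apply_apply]

variable {A : Type*} [NonUnitalCommRing A] [Module (ZMod p) A]

theorem symm_of_mem_transportedStructures
    {μ : FpVec p n →ₗ[ZMod p] FpVec p n →ₗ[ZMod p] FpVec p n}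
    (hμ : μ ∈ transportedStructures p n A) (x y : FpVec p n) : μ x y = μ y x := by
  obtain ⟨e, he⟩ := hμ
  rw [← e.apply_symm_apply x, ← e.apply_symm_apply y, ← he, ← he, mul_comm]

theorem mul_mul_eq_zero_of_mem_transportedStructures (hcube : ∀ x y z : A, x * y * z = 0)
    {μ : FpVec p n →ₗ[ZMod p] FpVec p n →ₗ[ZMod p] FpVec p n}
    (hμ : μ ∈ transportedStructures p n A) (x y z : FpVec p n) : μ (μ x y) z = 0 := by
  obtain ⟨e, he⟩ := hμ
  rw [← e.apply_symm_apply x, ← e.apply_symm_apply y, ← e.apply_symm_apply z, ← he, ← he, hcube,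
    map_zero]

theorem ncard_associatedRegularSubgroups (hcube : ∀ x y z : A, x * y * z = 0) :
    (associatedRegularSubgroups p n A).ncard = (transportedStructures p n A).ncard := by
  symm
  refine Set.ncard_congr (fun μ hμ => circleSubgroup μ (symm_of_mem_transportedStructures hμ)
    (mul_mul_eq_zero_of_mem_transportedStructures hcube hμ)) ?_ ?_ ?_
  · intro μ hμ
    refine ⟨isRegularSubgroup_circleSubgroup _ _ _, μ, hμ, ?_⟩
    ext f
    constructor
    · rintro ⟨t, ⟨x, hx⟩, rfl⟩
      exact ⟨x, hx.symm⟩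
    · rintro ⟨x, rfl⟩
      exact ⟨circleAffineEquiv μ (symm_of_mem_transportedStructures hμ)
        (mul_mul_eq_zero_of_mem_transportedStructures hcube hμ) x,
        ⟨x, coe_circleAffineEquiv _ _ _ _⟩, coe_circleAffineEquiv _ _ _ _⟩
  · intro μ μ' hμ hμ' h
    refine LinearMap.ext₂ fun x y => ?_
    have hx : circleAffineEquiv μ (symm_of_mem_transportedStructures hμ)
        (mul_mul_eq_zero_of_mem_transportedStructures hcube hμ) x ∈ circleSubgroup μ'
        (symm_of_mem_transportedStructures hμ')
        (mul_mul_eq_zero_of_mem_transportedStructures hcube hμ') :=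
      h ▸ ⟨x, coe_circleAffineEquiv _ _ _ _⟩
    obtain ⟨x', hx'⟩ := hx
    rw [coe_circleAffineEquiv] at hx'
    have h0 := congrFun hx' 0
    -- Evaluation at 0 reads off the parameter, so equal maps have equal x and hence equal products.
    simp only [circleProductMap, map_zero, add_zero] at h0
    subst h0
    exact add_left_cancel (congrFun hx' y)
  · rintro T ⟨-, μ, hμ, hT⟩
    refine ⟨μ, hμ, ?_⟩
    ext t
    rw [mem_circleSubgroup]
    constructor
    · rintro ⟨x, hx⟩
      have hmem : (t : FpVec p n → FpVec p n) ∈ Set.range (circleProductMap μ) := ⟨x, hx.symm⟩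
      rw [← hT] at hmem
      obtain ⟨t', ht', h⟩ := hmem
      rwa [← DFunLike.coe_injective h]
    · intro ht
      have hmem : (t : FpVec p n → FpVec p n) ∈ Set.range (circleProductMap μ) :=
        hT ▸ ⟨t, ht, rfl⟩
      obtain ⟨x, hx⟩ := hmem
      exact ⟨x, hx.symm⟩

/-- The linear automorphisms of `A` that are multiplicative. -/
abbrev MulLinearAut (p : ℕ) (A : Type*) [NonUnitalCommRing A] [Module (ZMod p) A] : Type _ :=
  {f : A ≃ₗ[ZMod p] A // ∀ x y, f (x * y) = f x * f y}

theorem card_linearEquiv [Fact p.Prime] (hdim : Module.finrank (ZMod p) A = n)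
    [Module.Finite (ZMod p) A] :
    Nat.card (A ≃ₗ[ZMod p] FpVec p n) = Nat.card (GL (Fin n) (ZMod p)) := by
  let e : A ≃ₗ[ZMod p] FpVec p n := (Module.finBasisOfFinrankEq (ZMod p) A hdim).equivFun
  refine Nat.card_congr (Equiv.trans (Equiv.trans ?_
    (LinearMap.GeneralLinearGroup.generalLinearEquiv (ZMod p) (FpVec p n)).symm.toEquiv)
    Matrix.GeneralLinearGroup.toLin.symm.toEquiv)
  exact ⟨fun f => e.symm.trans f, fun f => e.trans f, fun f => by ext1; simp,
    fun f => by ext1; simp⟩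

variable [SMulCommClass (ZMod p) A A] [IsScalarTower (ZMod p) A A]

/-- Transport of the multiplication of `A` along a linear equivalence. -/
def transportMul (e : A ≃ₗ[ZMod p] FpVec p n) : transportedStructures p n A :=
  ⟨((LinearMap.mul (ZMod p) A).compl₁₂ e.symm.toLinearMap e.symm.toLinearMap).compr₂ e.toLinearMap,
    e, fun x y => by simp⟩

/-- The orbit-stabilizer decomposition for the linear identifications of `A` with `𝔽_p ^ n`. -/
theorem ncard_transportedStructures_mul_card :
    (transportedStructures p n A).ncard * Nat.card (MulLinearAut p A) =
      Nat.card (A ≃ₗ[ZMod p] FpVec p n) := by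
  choose e he using fun μ : transportedStructures p n A => μ.2
  have htr : ∀ f : A ≃ₗ[ZMod p] FpVec p n, ∀ x y,
      f (x * y) = (transportMul f).1 (f x) (f y) := by
    intro f x y
    simp [transportMul]
  have hsymm : ∀ μ x y, (e μ).symm (μ.1 x y) = (e μ).symm x * (e μ).symm y := by
    intro μ x y
    rw [LinearEquiv.symm_apply_eq, he]
    simp
  rw [← Nat.card_coe_set_eq, ← Nat.card_prod]
  -- Each structure μ has a chosen identification `e μ`; any other identification inducing μ differs
  -- from it by exactly one automorphism of `A`.
  refine Nat.card_congr
    ⟨fun q => q.2.1.trans (e q.1), fun f => (transportMul f, ⟨f.trans (e (transportMul f)).symm,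
      fun x y => ?_⟩), ?_, ?_⟩
  · simp only [LinearEquiv.trans_apply]
    rw [htr f, hsymm]
  · rintro ⟨μ, f, hf⟩
    have h1 : transportMul (f.trans (e μ)) = μ := by
      apply Subtype.ext
      refine LinearMap.ext₂ fun x y => ?_
      have h2 := htr (f.trans (e μ)) ((f.trans (e μ)).symm x) ((f.trans (e μ)).symm y)
      rw [LinearEquiv.apply_symm_apply, LinearEquiv.apply_symm_apply] at h2
      rw [← h2, LinearEquiv.trans_apply, hf, he]
      simp
    have h3 : f.trans ((e μ).trans (e μ).symm) = f := by
      ext x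
      simp
    simp only [h1]
    refine Prod.ext rfl (Subtype.ext ?_)
    exact h3
  · intro f
    ext1 x
    simp

end AlgebraStructures

/-! ### Automorphisms in block form -/

section Automorphisms

open Matrix

variable {p : ℕ} {A : Type*} [NonUnitalCommRing A] [Module (ZMod p) A]
  [SMulCommClass (ZMod p) A A] [IsScalarTower (ZMod p) A A]
  {J : Type*} [Fintype J] [DecidableEq J]

/-- A matrix defines a multiplicative map iff it is compatible with the structure matrix. -/
theorem toLin_mul_iff (b : Module.Basis J (ZMod p) A) (Φ : Matrix J J (ZMod p)) (l : J)
    (hb : ∀ i j, b i * b j = Φ i j • b l) {i₀ j₀ : J} (h0 : IsUnit (Φ i₀ j₀))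
    (M : Matrix J J (ZMod p)) :
    (∀ x y, toLin b b M (x * y) = toLin b b M x * toLin b b M y) ↔
      (∀ a, a ≠ l → M a l = 0) ∧ M.transpose * Φ * M = M l l • Φ := by
  have hbasis : (∀ x y, toLin b b M (x * y) = toLin b b M x * toLin b b M y) ↔
      ∀ i j, toLin b b M (b i * b j) = toLin b b M (b i) * toLin b b M (b j) := by
    refine ⟨fun h i j => h _ _, fun h => ?_⟩
    have : (LinearMap.mul (ZMod p) A).compr₂ (toLin b b M) =
        (LinearMap.mul (ZMod p) A).compl₁₂ (toLin b b M) (toLin b b M) :=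
      b.ext fun i => b.ext fun j => h i j
    intro x y
    exact LinearMap.congr_fun (LinearMap.congr_fun this x) y
  have hprod : ∀ i j, toLin b b M (b i) * toLin b b M (b j) =
      (M.transpose * Φ * M) i j • b l := by
    intro i j
    rw [toLin_self, toLin_self, Finset.sum_mul_sum, Finset.sum_comm]
    simp only [smul_mul_smul_comm, hb, smul_smul, Matrix.mul_apply, transpose_apply, Finset.sum_mul,
      Finset.sum_smul]
    refine Finset.sum_congr rfl fun x _ => Finset.sum_congr rfl fun y _ => ?_
    congr 1
    ring
  have hentry : (∀ i j, toLin b b M (b i * b j) = toLin b b M (b i) * toLin b b M (b j)) ↔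
      ∀ i j a, Φ i j * M a l = (M.transpose * Φ * M) i j * if a = l then 1 else 0 := by
    refine forall_congr' fun i => forall_congr' fun j => ?_
    rw [hprod, hb, map_smul, toLin_self, ← b.repr.injective.eq_iff, DFunLike.ext_iff]
    refine forall_congr' fun a => ?_
    simp [Finsupp.single_apply, eq_comm]
  rw [hbasis, hentry]
  constructor
  · intro h
    refine ⟨fun a ha => ?_, ?_⟩
    -- An invertible entry of Φ makes `b l` a unit multiple of a product, so its image must again be
    -- a multiple of `b l`.
    · have := h i₀ j₀ a
      rw [if_neg ha, mul_zero] at this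
      exact h0.mul_right_eq_zero.1 this
    · ext i j
      have := h i j l
      rw [if_pos rfl, mul_one] at this
      rw [← this, Matrix.smul_apply, smul_eq_mul, mul_comm]
  · rintro ⟨h1, h2⟩ i j a
    rw [h2, Matrix.smul_apply, smul_eq_mul]
    split_ifs with ha
    · rw [ha]
      ring
    · rw [h1 a ha]
      ring

variable [Fact p.Prime]

theorem card_mulLinearAut (b : Module.Basis J (ZMod p) A) (Φ : Matrix J J (ZMod p)) (l : J)
    (hb : ∀ i j, b i * b j = Φ i j • b l) {i₀ j₀ : J} (h0 : Φ i₀ j₀ ≠ 0) :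
    Nat.card (MulLinearAut p A) = Nat.card {M : Matrix J J (ZMod p) // M.det ≠ 0 ∧
      (∀ a, a ≠ l → M a l = 0) ∧ M.transpose * Φ * M = M l l • Φ} := by
  let F : MulLinearAut p A → {M : Matrix J J (ZMod p) // M.det ≠ 0 ∧
      (∀ a, a ≠ l → M a l = 0) ∧ M.transpose * Φ * M = M l l • Φ} := fun f =>
    ⟨LinearMap.toMatrix b b f.1.toLinearMap, by
      rw [LinearMap.det_toMatrix]
      exact (LinearEquiv.isUnit_det' f.1).ne_zero, by
      rw [← toLin_mul_iff b Φ l hb h0.isUnit]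
      simpa using f.2⟩
  refine Nat.card_congr (Equiv.ofBijective F ⟨?_, ?_⟩)
  · intro f g h
    have := (LinearMap.toMatrix b b).injective (congrArg Subtype.val h)
    exact Subtype.ext (LinearEquiv.toLinearMap_injective this)
  · rintro ⟨M, hdet, hM⟩
    refine ⟨⟨LinearEquiv.ofIsUnitDet (f := toLin b b M) (v := b) (v' := b) ?_, ?_⟩, ?_⟩
    · rw [LinearMap.toMatrix_toLin]
      exact hdet.isUnit
    · exact (toLin_mul_iff b Φ l hb h0.isUnit M).2 hM
    · apply Subtype.ext
      change LinearMap.toMatrix b b (toLin b b M) = M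
      rw [LinearMap.toMatrix_toLin]

variable {κ ρ : Type} [Fintype κ] [DecidableEq κ] [Fintype ρ] [DecidableEq ρ]

/-- The last column is c times the last basis vector, and comparing blocks in MᵀΦM = cΦ gives UᵀDU =
cD and UᵀDX = 0, hence X = 0. What remains is block triangular: the diagonal blocks U, W₁, c are
constrained, and the entries below them are free. -/
theorem card_block_matrices (D : Matrix κ κ (ZMod p)) (hD : D.det ≠ 0) :
    Nat.card {M : Matrix (κ ⊕ (ρ ⊕ Unit)) (κ ⊕ (ρ ⊕ Unit)) (ZMod p) // M.det ≠ 0 ∧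
      (∀ a, a ≠ Sum.inr (Sum.inr ()) → M a (Sum.inr (Sum.inr ())) = 0) ∧
      M.transpose * fromBlocks D 0 0 0 * M =
        M (Sum.inr (Sum.inr ())) (Sum.inr (Sum.inr ())) • fromBlocks D 0 0 0} =
      Nat.card (Similitudes D × Matrix (ρ ⊕ Unit) κ (ZMod p) × GL ρ (ZMod p) ×
        Matrix Unit ρ (ZMod p)) := by
  let F : (Similitudes D × Matrix (ρ ⊕ Unit) κ (ZMod p) × GL ρ (ZMod p) ×
      Matrix Unit ρ (ZMod p)) → Matrix (κ ⊕ (ρ ⊕ Unit)) (κ ⊕ (ρ ⊕ Unit)) (ZMod p) := fun q =>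
    fromBlocks q.1.2.1 0 q.2.1 (fromBlocks q.2.2.1.1 0 q.2.2.2
      (of fun _ _ => (q.1.1 : ZMod p)))
  have hdetU : ∀ (c : ZMod p) (U : Matrix κ κ (ZMod p)), c ≠ 0 →
      U.transpose * D * U = c • D → U.det ≠ 0 := by
    intro c U hc h hU
    have := congrArg det h
    rw [det_mul, hU, mul_zero, det_smul] at this
    exact mul_ne_zero (pow_ne_zero _ hc) hD this.symm
  symm
  refine Nat.card_congr (Equiv.ofBijective (fun q => ⟨F q, ?_, ?_, ?_⟩) ⟨?_, ?_⟩)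
  · simp only [F, det_fromBlocks_zero₁₂]
    refine mul_ne_zero (hdetU _ _ q.1.1.ne_zero q.1.2.2) (mul_ne_zero ?_ ?_)
    · exact ((isUnit_iff_isUnit_det _).1 q.2.2.1.isUnit).ne_zero
    · simp
  · rintro (a | a | a) ha
    · rfl
    · rfl
    · exact absurd rfl ha
  · simp only [F, fromBlocks_transpose, fromBlocks_multiply, fromBlocks_smul]
    simp [q.1.2.2]
  · rintro ⟨⟨c, U, hU⟩, Y, W, w⟩ ⟨⟨c', U', hU'⟩, Y', W', w'⟩ h
    have h1 := congrArg Subtype.val h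
    simp only [F] at h1
    rw [fromBlocks_inj, fromBlocks_inj] at h1
    obtain ⟨rfl, -, rfl, h2, -, rfl, h3⟩ := h1
    obtain rfl : c = c' := Units.ext (congrFun (congrFun h3 ()) ())
    obtain rfl : W = W' := Units.ext h2
    rfl
  · rintro ⟨M, hdet, hcol, hM⟩
    obtain ⟨U, X, Y, W, rfl⟩ : ∃ U X Y W, M = fromBlocks U X Y W :=
      ⟨_, _, _, _, (fromBlocks_toBlocks M).symm⟩
    obtain ⟨W₁, w₂, w₃, w₄, rfl⟩ : ∃ W₁ w₂ w₃ w₄, W = fromBlocks W₁ w₂ w₃ w₄ :=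
      ⟨_, _, _, _, (fromBlocks_toBlocks W).symm⟩
    obtain rfl : w₂ = 0 := by
      ext i j
      exact hcol (Sum.inr (Sum.inl i)) (by simp)
    simp only [fromBlocks_apply₂₂] at hM
    set c := w₄ () () with hc
    have hc0 : c ≠ 0 := by
      intro h0
      refine hdet (det_eq_zero_of_column_eq_zero (Sum.inr (Sum.inr ())) fun a => ?_)
      by_cases ha : a = Sum.inr (Sum.inr ())
      · rw [ha]
        exact h0
      · exact hcol a ha
    rw [fromBlocks_transpose, fromBlocks_multiply, fromBlocks_multiply, fromBlocks_smul,
      fromBlocks_inj] at hM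
    simp only [Matrix.mul_zero, Matrix.zero_mul, add_zero, smul_zero] at hM
    obtain ⟨hU, hX, -, -⟩ := hM
    have hU0 := hdetU c U hc0 hU
    obtain rfl : X = 0 := by
      have hunit : IsUnit (U.transpose * D).det := by
        rw [det_mul, det_transpose]
        exact (mul_ne_zero hU0 hD).isUnit
      rw [← nonsing_inv_mul_cancel_left (U.transpose * D) X hunit, hX, Matrix.mul_zero]
    rw [det_fromBlocks_zero₁₂, det_fromBlocks_zero₁₂] at hdet
    have hW : W₁.det ≠ 0 := fun h => hdet (by rw [h]; simp)
    refine ⟨⟨⟨Units.mk0 c hc0, U, hU⟩, Y, GeneralLinearGroup.mkOfDetNeZero W₁ hW, w₃⟩, ?_⟩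
    apply Subtype.ext
    have : (of fun _ _ => c : Matrix Unit Unit (ZMod p)) = w₄ := by
      ext i j
      rfl
    simp only [F, Units.val_mk0, this]
    rfl

end Automorphisms

/-! ### The order of the automorphism group in dimension n. -/

section Count

open Matrix

variable {p n k : ℕ} [Fact p.Prime]

/-- The blocks `k`, `n - 1 - k` and `1` of the index set. -/
def blockEquiv (hk : k < n) : Fin k ⊕ (Fin (n - 1 - k) ⊕ Unit) ≃ Fin n :=
  (((Equiv.refl _).sumCongr (((Equiv.refl _).sumCongr (Equiv.ofUnique Unit (Fin 1))).trans
    finSumFinEquiv)).trans finSumFinEquiv).trans (finCongr (by omega))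

theorem extendByZero_blockEquiv (hk : k < n) (D : Matrix (Fin k) (Fin k) (ZMod p))
    (i j : Fin k ⊕ (Fin (n - 1 - k) ⊕ Unit)) :
    extendByZero n D (blockEquiv hk i) (blockEquiv hk j) = fromBlocks D 0 0 0 i j := by
  rcases i with i | i | i <;> rcases j with j | j | j <;> simp [extendByZero, blockEquiv]

/-- The number of associated regular subgroups, in terms of the number of similitudes. -/
theorem ncard_associatedRegularSubgroups_mul {A : Type*} [NonUnitalCommRing A]
    [Module (ZMod p) A] [SMulCommClass (ZMod p) A A] [IsScalarTower (ZMod p) A A] (hk : k < n)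
    (hcube : ∀ x y z : A, x * y * z = 0)
    (D : Matrix (Fin k) (Fin k) (ZMod p)) (hD : D.det ≠ 0) {i₀ j₀ : Fin k} (h0 : D i₀ j₀ ≠ 0)
    (hΦ : IsStructureMatrix A (extendByZero n D)) :
    (associatedRegularSubgroups p n A).ncard * (Nat.card (Similitudes D) *
      Nat.card (GL (Fin (n - 1 - k)) (ZMod p)) * p ^ (k * (n - 1 - k) + (n - 1))) =
        Nat.card (GL (Fin n) (ZMod p)) := by
  obtain ⟨b, l, hl, hb⟩ := hΦ
  let e := blockEquiv hk
  have hle : l = e (Sum.inr (Sum.inr ())) := by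
    ext
    simp [e, blockEquiv]
    omega
  have hcard := card_mulLinearAut (b.reindex e.symm) (fromBlocks D 0 0 0) (Sum.inr (Sum.inr ()))
    (fun i j => by
      rw [Module.Basis.reindex_apply, Module.Basis.reindex_apply, Module.Basis.reindex_apply, hb,
        hle]
      simp only [Equiv.symm_symm, e, extendByZero_blockEquiv])
    (i₀ := Sum.inl i₀) (j₀ := Sum.inl j₀) h0
  rw [card_block_matrices D hD, Nat.card_prod, Nat.card_prod, Nat.card_prod] at hcard
  have hfin : Module.Finite (ZMod p) A := Module.Finite.of_basis b
  have hdim : Module.finrank (ZMod p) A = n := by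
    rw [Module.finrank_eq_card_basis b, Fintype.card_fin]
  rw [ncard_associatedRegularSubgroups hcube, ← card_linearEquiv hdim,
    ← ncard_transportedStructures_mul_card, hcard]
  congr 1
  have h1 : Nat.card (Matrix (Fin (n - 1 - k) ⊕ Unit) (Fin k) (ZMod p)) =
      p ^ ((n - 1 - k + 1) * k) := by
    simp [Nat.card_eq_fintype_card, Matrix, ← pow_mul, mul_comm]
  have h2 : Nat.card (Matrix Unit (Fin (n - 1 - k)) (ZMod p)) = p ^ (n - 1 - k) := by
    simp [Nat.card_eq_fintype_card, Matrix]
  -- The free entries are (n - k)·k below the similitude block and n - 1 - k in the bottom row.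
  have h3 : k * (n - 1 - k) + (n - 1) = (n - 1 - k + 1) * k + (n - 1 - k) := by
    have : n - 1 = (n - 1 - k) + k := by omega
    rw [add_mul, one_mul, add_assoc, add_comm k, ← this, mul_comm]
  rw [h1, h2, h3, pow_add]
  ring

end Count

/-! ### The forms `D_s` and the counting formula -/

section Formula

open Matrix

variable {p n k : ℕ}

/-- The diagonal of `D_s`. -/
def onesWith (p k : ℕ) (s : ZMod p) : Fin k → ZMod p := fun i => if (i : ℕ) + 1 = k then s else 1

theorem diagOnes_eq (s : ZMod p) : diagOnes p k s = diagonal (onesWith p k s) := rfl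

theorem prod_onesWith (hk : k ≠ 0) (s : ZMod p) : ∏ i, onesWith p k s i = s := by
  obtain ⟨k, rfl⟩ := Nat.exists_eq_succ_of_ne_zero hk
  rw [Finset.prod_eq_single (Fin.last k)]
  · simp [onesWith]
  · intro i _ hi
    have : (i : ℕ) ≠ k := fun h => hi (Fin.ext h)
    simp [onesWith, this]
  · simp

theorem onesWith_one : onesWith p k 1 = fun _ => 1 := by
  ext1 i
  simp [onesWith]

variable [Fact p.Prime]

theorem onesWith_ne_zero {s : ZMod p} (hs : s ≠ 0) (i : Fin k) : onesWith p k s i ≠ 0 := by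
  unfold onesWith
  split_ifs
  · exact hs
  · exact one_ne_zero

theorem det_diagOnes_ne_zero {s : ZMod p} (hs : s ≠ 0) : (diagOnes p k s).det ≠ 0 := by
  rw [diagOnes_eq, det_diagonal]
  exact Finset.prod_ne_zero_iff.2 fun i _ => onesWith_ne_zero hs i

theorem ringChar_zmod_ne_two (hp : p ≠ 2) : ringChar (ZMod p) ≠ 2 := by
  rwa [ZMod.ringChar_zmod_n]

/-- The quotient in the counting formula, from the number of similitudes. -/
theorem ncard_eq_countFormula {A : Type*} [NonUnitalCommRing A]
    [Module (ZMod p) A] [SMulCommClass (ZMod p) A A] [IsScalarTower (ZMod p) A A] (hk : k < n)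
    (hk0 : k ≠ 0) (hcube : ∀ x y z : A, x * y * z = 0) {s : ZMod p} (hs : s ≠ 0)
    (hΦ : IsStructureMatrix A (extendByZero n (diagOnes p k s))) {c : ℚ} {o : ℕ}
    (hsim : (Nat.card (Similitudes (diagOnes p k s)) : ℚ) = c * o) :
    ((associatedRegularSubgroups p n A).ncard : ℚ) = countFormula p n k c o := by
  have h0 : diagOnes p k s ⟨0, Nat.pos_of_ne_zero hk0⟩ ⟨0, Nat.pos_of_ne_zero hk0⟩ ≠ 0 := by
    rw [diagOnes_eq, diagonal_apply_eq]
    exact onesWith_ne_zero hs _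
  have h := ncard_associatedRegularSubgroups_mul hk hcube (diagOnes p k s)
    (det_diagOnes_ne_zero hs) h0 hΦ
  have hG : Nat.card (GL (Fin n) (ZMod p)) ≠ 0 := Nat.card_pos.ne'
  -- The denominator of the quotient is nonzero as a factor of |GL_n|.
  have hden := hG
  rw [← h] at hden
  rw [countFormula, ← hsim, ← h]
  have hden' := right_ne_zero_of_mul hden
  push_cast
  rw [eq_div_iff]
  exact_mod_cast hden'

/-- For even k the determinants of D_s and c·D_s differ by the square c^k, so every unit c is a
multiplier. -/
theorem card_similitudes_diagOnes_even (hp : p ≠ 2) (hk0 : k ≠ 0) (hk : Even k) {s : ZMod p}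
    (hs : s ≠ 0) : (Nat.card (Similitudes (diagOnes p k s)) : ℚ) =
      ((p : ℚ) - 1) * Nat.card (isometryGroup (diagOnes p k s)) := by
  have hne : Nonempty (Fin k) := ⟨⟨0, Nat.pos_of_ne_zero hk0⟩⟩
  rw [card_similitudes _ (det_diagOnes_ne_zero hs) (fun _ => True) (fun c _ => ?_)
    (fun _ _ _ => trivial)]
  · have : Nat.card {c : (ZMod p)ˣ // True} = p - 1 := by
      rw [Nat.card_congr (Equiv.subtypeUnivEquiv fun _ => trivial), Nat.card_eq_fintype_card,
        ZMod.card_units]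
    rw [this]
    push_cast [Nat.cast_sub (Fact.out : p.Prime).one_le]
    ring
  · rw [diagOnes_eq, ← diagonal_smul]
    refine isCongruent_diagonal_of_isSquare (ringChar_zmod_ne_two hp) rfl (onesWith_ne_zero hs)
      (fun i => mul_ne_zero c.ne_zero (onesWith_ne_zero hs i)) ?_
    simp only [Pi.smul_apply, smul_eq_mul, Finset.prod_mul_distrib, Finset.prod_const,
      Finset.card_univ, Fintype.card_fin]
    obtain ⟨m, rfl⟩ := hk
    exact ⟨(c : ZMod p) ^ m * ∏ i, onesWith p (m + m) s i, by ring⟩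

/-- A similitude satisfies det(X)² = c^k, which for odd k forces c to be a square; conversely c = d²
is the multiplier of scaling by d. -/
theorem card_similitudes_diagOnes_odd (hp : p ≠ 2) (hk : Odd k) :
    (Nat.card (Similitudes (diagOnes p k 1)) : ℚ) = ((p : ℚ) - 1) / 2 * cardGO p k := by
  have hk0 : k ≠ 0 := hk.pos.ne'
  have hne : Nonempty (Fin k) := ⟨⟨0, Nat.pos_of_ne_zero hk0⟩⟩
  have hD : diagOnes p k 1 = 1 := by
    rw [diagOnes_eq, onesWith_one, diagonal_one]
  rw [hD, card_similitudes _ (by simp) IsSquare (fun c hc => ?_) (fun c X hX => ?_), cardGO]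
  · have := card_isSquare_units hp
    have h2 : (2 : ℚ) * Nat.card {c : (ZMod p)ˣ // IsSquare c} = (p : ℚ) - 1 := by
      rw [← Nat.cast_one, ← Nat.cast_sub (Fact.out : p.Prime).one_le, ← this]
      push_cast
      ring
    push_cast
    rw [← h2]
    ring
  · obtain ⟨d, rfl⟩ := hc
    rw [← diagonal_one, ← diagonal_smul]
    have := IsCongruent.diagonal_scale (fun _ : Fin k => (1 : ZMod p)) (fun _ => (d : ZMod p))
      (fun _ => d.ne_zero)
    convert this using 2
    ext i
    simp [sq]
  · have h := congrArg det hX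
    rw [Matrix.mul_one, det_mul, det_transpose, det_smul, det_one, mul_one, Fintype.card_fin] at h
    obtain ⟨m, rfl⟩ := hk
    have hX0 : X.det ≠ 0 := by
      intro h0
      rw [h0, mul_zero] at h
      exact pow_ne_zero _ c.ne_zero h.symm
    -- From det(X)² = c^(2m+1), the square root of c is det(X)/c^m.
    refine ⟨Units.mk0 X.det hX0 * (c ^ m)⁻¹, ?_⟩
    have : Units.mk0 X.det hX0 * Units.mk0 X.det hX0 = c ^ (2 * m + 1) := by
      ext
      simpa using h
    calc c = c ^ (2 * m + 1) * (c ^ m)⁻¹ * (c ^ m)⁻¹ := by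
          rw [pow_succ, two_mul, pow_add]
          group
      _ = _ := by
          rw [← this, mul_mul_mul_comm, mul_assoc]

/-! ### Forms of plus and minus type -/

theorem isCongruent_hyperbolicForm (hp : p ≠ 2) (m : ℕ) :
    IsCongruent (hyperbolicForm p m)
      (diagonal (Sum.elim (fun _ : Fin m => (1 : ZMod p)) (fun _ : Fin m => -1))) := by
  have h2 : (2 : ZMod p) ≠ 0 := Ring.two_ne_zero (ringChar_zmod_ne_two hp)
  have h3 : (2 : Matrix (Fin m) (Fin m) (ZMod p)) * diagonal (fun _ => 2⁻¹) = 1 := by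
    rw [two_mul, diagonal_add, ← diagonal_one]
    congr 1
    ext i
    rw [← two_mul, mul_inv_cancel₀ h2]
  rw [← fromBlocks_diagonal, hyperbolicForm]
  -- For each hyperbolic pair e, f the new basis is e + f/2, e - f/2, of norms 1 and -1.
  refine ⟨fromBlocks 1 1 (diagonal fun _ => 2⁻¹) (diagonal fun _ => -2⁻¹),
    fromBlocks (diagonal fun _ => 2⁻¹) 1 (diagonal fun _ => 2⁻¹) (-1), ?_, ?_, ?_⟩
  · rw [fromBlocks_multiply, ← fromBlocks_one]
    simp [← two_mul, h3]
  · rw [fromBlocks_multiply, ← fromBlocks_one]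
    simp [← two_mul, h3]
  · have h4 : (diagonal fun _ => -2⁻¹ : Matrix (Fin m) (Fin m) (ZMod p)) =
        -diagonal fun _ => 2⁻¹ := by
      rw [diagonal_neg]
    have h5 : (diagonal fun _ => -1 : Matrix (Fin m) (Fin m) (ZMod p)) = -1 := by
      rw [← diagonal_one, diagonal_neg]
    rw [fromBlocks_transpose, fromBlocks_multiply, fromBlocks_multiply, h4, h5]
    simp [← two_mul, h3, -diagonal_neg]

/-- A sum of m hyperbolic planes has determinant (-1)^m, so the hypothesis says that the two
determinants agree modulo squares. -/
theorem card_isometryGroup_diagOnes_plus (hp : p ≠ 2) {m : ℕ} (hm : m ≠ 0) {s : ZMod p}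
    (hs : s ≠ 0) (h : IsSquare ((-1) ^ m * s)) :
    Nat.card (isometryGroup (diagOnes p (2 * m) s)) = cardGOPlus p m := by
  have hne : Nonempty (Fin m ⊕ Fin m) := ⟨Sum.inl ⟨0, Nat.pos_of_ne_zero hm⟩⟩
  symm
  refine card_isometryGroup_eq ((isCongruent_hyperbolicForm hp m).trans ?_)
  refine isCongruent_diagonal_of_isSquare (ringChar_zmod_ne_two hp) (by simp [two_mul]) ?_
    (onesWith_ne_zero hs) ?_
  · rintro (i | i) <;> simp
  · change IsSquare (_ * ∏ i, onesWith p (2 * m) s i)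
    rw [prod_onesWith (by omega)]
    simpa using h

/-- The elliptic form has determinant (-1)^(m-1)·(-δ) = (-1)^m·δ. -/
theorem card_isometryGroup_diagOnes_minus (hp : p ≠ 2) {m : ℕ} (hm : m ≠ 0) {s δ : ZMod p}
    (hs : s ≠ 0) (hδ : δ ≠ 0) (h : IsSquare ((-1) ^ m * (δ * s))) :
    Nat.card (isometryGroup (diagOnes p (2 * m) s)) = cardGOMinus p m δ := by
  symm
  refine card_isometryGroup_eq (((isCongruent_hyperbolicForm hp (m - 1)).fromBlocks
    (IsCongruent.refl _)).trans ?_)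
  rw [fromBlocks_diagonal]
  refine isCongruent_diagonal_of_isSquare (ringChar_zmod_ne_two hp) (by simp; omega) ?_
    (onesWith_ne_zero hs) ?_
  · rintro ((i | i) | i)
    · simp
    · simp
    · fin_cases i <;> simp [hδ]
  · change IsSquare (_ * ∏ i, onesWith p (2 * m) s i)
    rw [prod_onesWith (by omega)]
    obtain ⟨m, rfl⟩ := Nat.exists_eq_succ_of_ne_zero hm
    convert h using 1
    simp [pow_succ, mul_assoc]

theorem isSquare_neg_one_pow {m : ℕ} (h : Even m ∨ p % 4 = 1) : IsSquare ((-1 : ZMod p) ^ m) := by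
  rcases h with h | h
  · exact h.isSquare_pow _
  · exact (ZMod.exists_sq_eq_neg_one_iff.2 (by omega)).pow m

theorem not_isSquare_neg_one_pow (hp : p ≠ 2) {m : ℕ} (h : ¬(Even m ∨ p % 4 = 1)) :
    ¬IsSquare ((-1 : ZMod p) ^ m) := by
  rw [not_or, Nat.not_even_iff_odd] at h
  rw [h.1.neg_one_pow, ZMod.exists_sq_eq_neg_one_iff, not_not]
  have := (Fact.out : p.Prime).eq_two_or_odd
  omega

theorem isSquare_mul_of_not_isSquare {a b : ZMod p} (ha : ¬IsSquare a)
    (hb : ¬IsSquare b) : IsSquare (a * b) := by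
  have h0 : a * b ≠ 0 := by
    refine mul_ne_zero ?_ ?_ <;> rintro rfl
    · exact ha IsSquare.zero
    · exact hb IsSquare.zero
  rw [← quadraticChar_one_iff_isSquare h0, map_mul,
    (quadraticChar_neg_one_iff_not_isSquare (a := a)).2 ha,
    (quadraticChar_neg_one_iff_not_isSquare (a := b)).2 hb]
  rfl

end Formula

/-! ### Assembly of the cases. -/

theorem squareSpan_eq_bot_of_isStructureMatrix_zero {p n : ℕ} {A : Type*} [NonUnitalCommRing A]
    [Module (ZMod p) A] [SMulCommClass (ZMod p) A A] [IsScalarTower (ZMod p) A A]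
    (hΦ : IsStructureMatrix A (0 : Matrix (Fin n) (Fin n) (ZMod p))) : squareSpan p A = ⊥ := by
  obtain ⟨b, l, -, hb⟩ := hΦ
  have : LinearMap.mul (ZMod p) A = 0 := b.ext fun i => b.ext fun j => by simp [hb]
  rw [squareSpan, Submodule.span_eq_bot]
  rintro _ ⟨x, y, rfl⟩
  exact LinearMap.congr_fun (LinearMap.congr_fun this x) y

end

theorem corollary5p3 {p : ℕ} [Fact p.Prime] (hp : p ≠ 2) {n k : ℕ} (hk : k < n) (s : ZMod p)
    (A : Type*) [NonUnitalCommRing A] [Module (ZMod p) A]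
    [SMulCommClass (ZMod p) A A] [IsScalarTower (ZMod p) A A]
    (hdim : Module.finrank (ZMod p) A = n)
    (hcube : ∀ x y z : A, x * y * z = 0)
    (hsq : Module.finrank (ZMod p) (squareSpan p A) = 1)
    (hΦ : IsStructureMatrix A (extendByZero n (diagOnes p k s))) :
    -- the number of regular subgroups
    (∀ m : ℕ, k = 2 * m + 1 → s = 1 →
      ((associatedRegularSubgroups p n A).ncard : ℚ) =
        countFormula p n k (((p : ℚ) - 1) / 2) (cardGO p (2 * m + 1))) ∧
    (∀ m : ℕ, k = 2 * m → s = 1 →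
      ((associatedRegularSubgroups p n A).ncard : ℚ) =
        countFormula p n k ((p : ℚ) - 1) (Nat.card (isometryGroup (diagOnes p k s))) ∧
      ((Even m ∨ p % 4 = 1) →
        ((associatedRegularSubgroups p n A).ncard : ℚ) =
          countFormula p n k ((p : ℚ) - 1) (cardGOPlus p m)) ∧
      (¬ (Even m ∨ p % 4 = 1) → ∀ δ : ZMod p, ¬ IsSquare δ →
        ((associatedRegularSubgroups p n A).ncard : ℚ) =
          countFormula p n k ((p : ℚ) - 1) (cardGOMinus p m δ))) ∧
    (∀ m : ℕ, k = 2 * m → ¬ IsSquare s →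
      ((associatedRegularSubgroups p n A).ncard : ℚ) =
        countFormula p n k ((p : ℚ) - 1) (Nat.card (isometryGroup (diagOnes p k s))) ∧
      ((Even m ∨ p % 4 = 1) → ∀ δ : ZMod p, ¬ IsSquare δ →
        ((associatedRegularSubgroups p n A).ncard : ℚ) =
          countFormula p n k ((p : ℚ) - 1) (cardGOMinus p m δ)) ∧
      (¬ (Even m ∨ p % 4 = 1) →
        ((associatedRegularSubgroups p n A).ncard : ℚ) =
          countFormula p n k ((p : ℚ) - 1) (cardGOPlus p m))) ∧
    -- the number of Hopf Galois structures is the same, for every Galois extension `L/K` with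
    -- Galois group identified with `𝔽_p ^ n`
    (∀ (K : Type u) (L : Type v) [Field K] [Field L] [Algebra K L] [FiniteDimensional K L]
      [IsGalois K L] (σ : Multiplicative (FpVec p n) ≃* (L ≃ₐ[K] L)),
      (associatedHopfGaloisStructures K L σ A).ncard =
        (associatedRegularSubgroups p n A).ncard) := by
  -- For k = 0 the structure matrix is zero, which would give A² = 0 instead of dimension 1.
  have hk0 : k ≠ 0 := by
    rintro rfl
    have h0 : extendByZero n (diagOnes p 0 s) = 0 := by
      ext i j
      simp [extendByZero]
    rw [h0] at hΦ
    rw [squareSpan_eq_bot_of_isStructureMatrix_zero hΦ, finrank_bot] at hsq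
    exact zero_ne_one hsq
  have hne : ∀ {a : ZMod p}, ¬ IsSquare a → a ≠ 0 := by
    rintro a ha rfl
    exact ha IsSquare.zero
  refine ⟨?_, ?_, ?_, fun K L _ _ _ _ _ σ => ncard_associatedHopfGaloisStructures hcube σ⟩
  · rintro m rfl rfl
    exact ncard_eq_countFormula hk hk0 hcube one_ne_zero hΦ
      (card_similitudes_diagOnes_odd hp (odd_two_mul_add_one m))
  · rintro m rfl rfl
    have hm : m ≠ 0 := by omega
    have h := ncard_eq_countFormula hk hk0 hcube one_ne_zero hΦ
      (card_similitudes_diagOnes_even hp hk0 (even_two_mul m) one_ne_zero)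
    refine ⟨h, fun hm4 => ?_, fun hm4 δ hδ => ?_⟩
    · rw [h, card_isometryGroup_diagOnes_plus hp hm one_ne_zero
        (by rw [mul_one]; exact isSquare_neg_one_pow hm4)]
    · rw [h, card_isometryGroup_diagOnes_minus hp hm one_ne_zero (hne hδ)
        (by rw [mul_one]; exact isSquare_mul_of_not_isSquare (not_isSquare_neg_one_pow hp hm4) hδ)]
  · rintro m rfl hs
    have hm : m ≠ 0 := by omega
    have h := ncard_eq_countFormula hk hk0 hcube (hne hs) hΦ
      (card_similitudes_diagOnes_even hp hk0 (even_two_mul m) (hne hs))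
    refine ⟨h, fun hm4 δ hδ => ?_, fun hm4 => ?_⟩
    · rw [h, card_isometryGroup_diagOnes_minus hp hm (hne hs) (hne hδ)
        ((isSquare_neg_one_pow hm4).mul (isSquare_mul_of_not_isSquare hδ hs))]
    · rw [h, card_isometryGroup_diagOnes_plus hp hm (hne hs)
        (isSquare_mul_of_not_isSquare (not_isSquare_neg_one_pow hp hm4) hs)]
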